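/- A Poisson algebra over a field $k$ is a $k$-vector space with a commutative associative bilinear product $x\cdot y$ (not necessarily unital) and a Lie bracket $(x,y)$ (bilinear, with $(x,x)=0$ and the Jacobi identity) such that $(x,y\cdot z)=(x,y)\cdot z+y\cdot(x,z)$. It is abelian if both operations are zero, and metabelian if it is an extension of an abelian Poisson algebra by an abelian Poisson algebra. Let $X=\{b_1,\dots,b_n\}$ be a finite set and let $\mathcal{MP}_k(X)$ be the free metabelian Poisson algebra generated by $X$. It is the direct sum of the subspace $kX$, which has basis $X$, and the subspace spanned by the monomials of length at least $2$, where the length of a monomial (formed from letters of $X$ by products and brackets) is its number of letters, counted with repetitions. Write $f=f^{(1)}+f^{(2)}$ for the corresponding decomposition of $f\in\mathcal{MP}_k(X)$ into its linear and nonlinear parts. **Theorem.** Let $\varphi$ be an endomorphism of $\mathcal{MP}_k(X)$, put $f_i=\varphi(b_i)$ for $1\le i\le n$, and let $\tilde\varphi$ be the linear endomorphism of $kX$ with $\tilde\varphi(b_i)=f_i^{(1)}$ for $1\le i\le n$. Then $\varphi$ is an automorphism of $\mathcal{MP}_k(X)$ if and only if $\tilde\varphi$ is an isomorphism of $kX$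 and, for every $m\le n$, the element $f_m^{(2)}$ lies in the Poisson ideal of $\mathcal{MP}_k(X)$ generated by the set $$S=\{(f_i,f_j),\ f_i\cdot f_j \mid 1\le i,j\le n\}.$$ Moreover, if $k$ is a computable field (its elements are coded effectively, with decidable equality, and there are algorithms for addition, multiplication, negation and inversion), then there is an algorithm which, given $n$ and $f_1,\dots,f_n\in\mathcal{MP}_k(\{b_1,\dots,b_n\})$, each written as a finite list of terms $\alpha\,[a_1,\dots,a_m]\cdot c_1\cdots c_s$ with $\alpha\in k$, letters $a_1,\dots,a_m,c_1,\dots,c_s$, $m\ge1$, $s\ge0$ and $[a_1,\dots,a_m]=(\dots((a_1,a_2),a_3),\dots,a_m)$, decides whether the endomorphism with $b_i\mapsto f_i$ for $1\le i\le n$ is an automorphism. -/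

import Mathlib

universe u v w

/-! ## Poisson algebras -/

/-- The ring-theoretic part of a (not necessarily unital) Poisson algebra: a commutative
associative multiplication and a Lie bracket on the same additive group, related by the
Leibniz identity. The bracket `⁅x, y⁆` is alternating, also in characteristic two. -/
class PoissonRing (P : Type u) extends NonUnitalCommRing P, LieRing P where
  leibniz : ∀ x y z : P, ⁅x, y * z⁆ = ⁅x, y⁆ * z + y * ⁅x, z⁆

/-- A Poisson algebra over the field `k`: both operations are `k`-bilinear. -/
class PoissonAlgebra (k : Type u) (P : Type v) [Field k] [PoissonRing P]
    extends LieAlgebra k P where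
  smul_mul : ∀ (c : k) (x y : P), (c • x) * y = c • (x * y)

/-- Homomorphisms of Poisson algebras. -/
structure PoissonHom (k : Type u) (P : Type v) (Q : Type w) [Field k] [PoissonRing P]
    [PoissonAlgebra k P] [PoissonRing Q] [PoissonAlgebra k Q] extends P →ₗ[k] Q where
  map_mul : ∀ x y : P, toFun (x * y) = toFun x * toFun y
  map_lie : ∀ x y : P, toFun ⁅x, y⁆ = ⁅toFun x, toFun y⁆

instance PoissonHom.instCoeFun (k : Type u) (P : Type v) (Q : Type w) [Field k] [PoissonRing P]
    [PoissonAlgebra k P] [PoissonRing Q] [PoissonAlgebra k Q] :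
    CoeFun (PoissonHom k P Q) (fun _ => P → Q) :=
  ⟨fun φ => φ.toFun⟩

/-- Poisson ideals: subspaces absorbing both operations. -/
def IsPoissonIdeal {k : Type u} {P : Type v} [Field k] [PoissonRing P] [PoissonAlgebra k P]
    (I : Submodule k P) : Prop :=
  ∀ x ∈ I, ∀ p : P, x * p ∈ I ∧ ⁅x, p⁆ ∈ I

/-- The Poisson ideal `Id(S)` generated by a set `S`. -/
def poissonIdeal (k : Type u) {P : Type v} [Field k] [PoissonRing P] [PoissonAlgebra k P]
    (S : Set P) : Submodule k P :=
  sInf {I : Submodule k P | IsPoissonIdeal I ∧ S ⊆ I}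

/-- A Poisson algebra is metabelian if it is an extension of an abelian Poisson algebra by an
abelian one: some Poisson ideal `I` has zero operations and all products and brackets lie in `I`,
so that the quotient by `I` has zero operations as well. -/
def IsMetabelianPoisson (k : Type u) (P : Type v) [Field k] [PoissonRing P]
    [PoissonAlgebra k P] : Prop :=
  ∃ I : Submodule k P, IsPoissonIdeal I ∧
    (∀ x ∈ I, ∀ y ∈ I, x * y = 0 ∧ ⁅x, y⁆ = 0) ∧
    (∀ x y : P, x * y ∈ I ∧ ⁅x, y⁆ ∈ I)

theorem isPoissonIdeal_poissonIdeal (k : Type u) {P : Type v} [Field k] [PoissonRing P]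
    [PoissonAlgebra k P] (S : Set P) : IsPoissonIdeal (poissonIdeal k S) := fun x hx p =>
  ⟨Submodule.mem_sInf.mpr fun I hI => (hI.1 x (Submodule.mem_sInf.mp hx I hI) p).1,
    Submodule.mem_sInf.mpr fun I hI => (hI.1 x (Submodule.mem_sInf.mp hx I hI) p).2⟩

/-! ## The free metabelian Poisson algebra -/

namespace FreeMP

/-- Formal Poisson expressions in the letters `X` with scalars in `k`. -/
inductive Pre (k : Type u) (X : Type v) : Type (max u v)
  | of : X → Pre k X
  | zero : Pre k X
  | add : Pre k X → Pre k X → Pre k X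
  | smul : k → Pre k X → Pre k X
  | mul : Pre k X → Pre k X → Pre k X
  | lie : Pre k X → Pre k X → Pre k X

/-- The identities of metabelian Poisson algebras, closed under the operations. -/
inductive Rel (k : Type u) (X : Type v) [Field k] : Pre k X → Pre k X → Prop
  -- compatibility with the operations
  | add_left {a b : Pre k X} (c : Pre k X) : Rel k X a b → Rel k X (.add a c) (.add b c)
  | add_right {a b : Pre k X} (c : Pre k X) : Rel k X a b → Rel k X (.add c a) (.add c b)
  | smul_congr {a b : Pre k X} (t : k) : Rel k X a b → Rel k X (.smul t a) (.smul t b)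
  | mul_left {a b : Pre k X} (c : Pre k X) : Rel k X a b → Rel k X (.mul a c) (.mul b c)
  | mul_right {a b : Pre k X} (c : Pre k X) : Rel k X a b → Rel k X (.mul c a) (.mul c b)
  | lie_left {a b : Pre k X} (c : Pre k X) : Rel k X a b → Rel k X (.lie a c) (.lie b c)
  | lie_right {a b : Pre k X} (c : Pre k X) : Rel k X a b → Rel k X (.lie c a) (.lie c b)
  -- vector space
  | add_assoc (a b c : Pre k X) : Rel k X (.add (.add a b) c) (.add a (.add b c))
  | add_comm (a b : Pre k X) : Rel k X (.add a b) (.add b a)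
  | zero_add (a : Pre k X) : Rel k X (.add .zero a) a
  | smul_add (t : k) (a b : Pre k X) :
      Rel k X (.smul t (.add a b)) (.add (.smul t a) (.smul t b))
  | add_smul (s t : k) (a : Pre k X) :
      Rel k X (.smul (s + t) a) (.add (.smul s a) (.smul t a))
  | mul_smul (s t : k) (a : Pre k X) : Rel k X (.smul (s * t) a) (.smul s (.smul t a))
  | one_smul (a : Pre k X) : Rel k X (.smul 1 a) a
  | zero_smul (a : Pre k X) : Rel k X (.smul 0 a) .zero
  -- commutative associative algebra
  | add_mul (a b c : Pre k X) : Rel k X (.mul (.add a b) c) (.add (.mul a c) (.mul b c))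
  | smul_mul (t : k) (a b : Pre k X) : Rel k X (.mul (.smul t a) b) (.smul t (.mul a b))
  | mul_comm (a b : Pre k X) : Rel k X (.mul a b) (.mul b a)
  | mul_assoc (a b c : Pre k X) : Rel k X (.mul (.mul a b) c) (.mul a (.mul b c))
  -- Lie algebra
  | add_lie (a b c : Pre k X) : Rel k X (.lie (.add a b) c) (.add (.lie a c) (.lie b c))
  | lie_add (a b c : Pre k X) : Rel k X (.lie a (.add b c)) (.add (.lie a b) (.lie a c))
  | lie_smul (t : k) (a b : Pre k X) : Rel k X (.lie a (.smul t b)) (.smul t (.lie a b))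
  | lie_self (a : Pre k X) : Rel k X (.lie a a) .zero
  | jacobi (a b c : Pre k X) :
      Rel k X (.lie a (.lie b c)) (.add (.lie (.lie a b) c) (.lie b (.lie a c)))
  -- Leibniz identity
  | leibniz (a b c : Pre k X) :
      Rel k X (.lie a (.mul b c)) (.add (.mul (.lie a b) c) (.mul b (.lie a c)))
  -- metabelian identities: the operations vanish on products and brackets
  | mul_mul_mul (a b c d : Pre k X) : Rel k X (.mul (.mul a b) (.mul c d)) .zero
  | mul_mul_lie (a b c d : Pre k X) : Rel k X (.mul (.mul a b) (.lie c d)) .zero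
  | mul_lie_lie (a b c d : Pre k X) : Rel k X (.mul (.lie a b) (.lie c d)) .zero
  | lie_mul_mul (a b c d : Pre k X) : Rel k X (.lie (.mul a b) (.mul c d)) .zero
  | lie_mul_lie (a b c d : Pre k X) : Rel k X (.lie (.mul a b) (.lie c d)) .zero
  | lie_lie_lie (a b c d : Pre k X) : Rel k X (.lie (.lie a b) (.lie c d)) .zero

end FreeMP

/-- The free metabelian Poisson algebra `MP_k(X)` on the set `X` over the field `k`. -/
def FreeMP (k : Type u) (X : Type v) [Field k] : Type (max u v) := Quot (FreeMP.Rel k X)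

namespace FreeMP

section Structure

variable (k : Type u) (X : Type v) [Field k]

instance instAdd : Add (FreeMP k X) :=
  ⟨Quot.map₂ Pre.add (fun a _ _ h => Rel.add_right a h) (fun _ _ c h => Rel.add_left c h)⟩

instance instZero : Zero (FreeMP k X) := ⟨Quot.mk _ Pre.zero⟩

instance instSMul : SMul k (FreeMP k X) :=
  ⟨fun t => Quot.map (Pre.smul t) (fun _ _ h => Rel.smul_congr t h)⟩

instance instMul : Mul (FreeMP k X) :=
  ⟨Quot.map₂ Pre.mul (fun a _ _ h => Rel.mul_right a h) (fun _ _ c h => Rel.mul_left c h)⟩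

instance instBracket : Bracket (FreeMP k X) (FreeMP k X) :=
  ⟨Quot.map₂ Pre.lie (fun a _ _ h => Rel.lie_right a h) (fun _ _ c h => Rel.lie_left c h)⟩

instance instNeg : Neg (FreeMP k X) := ⟨fun a => (-1 : k) • a⟩

instance instAddCommGroup : AddCommGroup (FreeMP k X) where
  add_assoc := by rintro ⟨a⟩ ⟨b⟩ ⟨c⟩; exact Quot.sound (Rel.add_assoc a b c)
  zero_add := by rintro ⟨a⟩; exact Quot.sound (Rel.zero_add a)
  add_zero := by
    rintro ⟨a⟩
    exact (Quot.sound (Rel.add_comm a .zero)).trans (Quot.sound (Rel.zero_add a))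
  add_comm := by rintro ⟨a⟩ ⟨b⟩; exact Quot.sound (Rel.add_comm a b)
  neg_add_cancel := by
    rintro ⟨a⟩
    have h1 : (Quot.mk (Rel k X) (.smul (-1 + 1) a)) =
        Quot.mk _ (.add (.smul (-1) a) (.smul 1 a)) := Quot.sound (Rel.add_smul (-1) 1 a)
    have h2 : (Quot.mk (Rel k X) (.add (.smul (-1) a) (.smul 1 a))) =
        Quot.mk _ (.add (.smul (-1) a) a) := Quot.sound (Rel.add_right _ (Rel.one_smul a))
    have h3 : (Quot.mk (Rel k X) (.smul 0 a)) = Quot.mk _ .zero := Quot.sound (Rel.zero_smul a)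
    rw [neg_add_cancel] at h1
    exact (h2.symm.trans h1.symm).trans h3
  nsmul := nsmulRec
  zsmul := zsmulRec

instance instModule : Module k (FreeMP k X) where
  one_smul := by rintro ⟨a⟩; exact Quot.sound (Rel.one_smul a)
  mul_smul := by rintro s t ⟨a⟩; exact Quot.sound (Rel.mul_smul s t a)
  smul_zero := by
    intro t
    have h0 : (0 : k) • (0 : FreeMP k X) = 0 := Quot.sound (Rel.zero_smul .zero)
    have h1 : (t * 0) • (0 : FreeMP k X) = t • ((0 : k) • (0 : FreeMP k X)) :=
      Quot.sound (Rel.mul_smul t 0 .zero)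
    rw [h0, mul_zero, h0] at h1
    exact h1.symm
  smul_add := by rintro t ⟨a⟩ ⟨b⟩; exact Quot.sound (Rel.smul_add t a b)
  add_smul := by rintro s t ⟨a⟩; exact Quot.sound (Rel.add_smul s t a)
  zero_smul := by rintro ⟨a⟩; exact Quot.sound (Rel.zero_smul a)

theorem mul_comm' (a b : FreeMP k X) : a * b = b * a := by
  obtain ⟨a⟩ := a; obtain ⟨b⟩ := b; exact Quot.sound (Rel.mul_comm a b)

theorem add_mul' (a b c : FreeMP k X) : (a + b) * c = a * c + b * c := by
  obtain ⟨a⟩ := a; obtain ⟨b⟩ := b; obtain ⟨c⟩ := c; exact Quot.sound (Rel.add_mul a b c)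

theorem zero_mul' (a : FreeMP k X) : 0 * a = 0 := by
  have h := add_mul' k X 0 0 a
  rw [add_zero] at h
  exact left_eq_add.mp h

instance instPoissonRing : PoissonRing (FreeMP k X) where
  __ := instAddCommGroup k X
  left_distrib a b c := by
    rw [mul_comm' k X a, mul_comm' k X a, mul_comm' k X a, add_mul']
  right_distrib := add_mul' k X
  zero_mul := zero_mul' k X
  mul_zero a := by rw [mul_comm', zero_mul']
  mul_assoc := by rintro ⟨a⟩ ⟨b⟩ ⟨c⟩; exact Quot.sound (Rel.mul_assoc a b c)
  mul_comm := mul_comm' k X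
  add_lie := by rintro ⟨a⟩ ⟨b⟩ ⟨c⟩; exact Quot.sound (Rel.add_lie a b c)
  lie_add := by rintro ⟨a⟩ ⟨b⟩ ⟨c⟩; exact Quot.sound (Rel.lie_add a b c)
  lie_self := by rintro ⟨a⟩; exact Quot.sound (Rel.lie_self a)
  leibniz_lie := by rintro ⟨a⟩ ⟨b⟩ ⟨c⟩; exact Quot.sound (Rel.jacobi a b c)
  leibniz := by rintro ⟨a⟩ ⟨b⟩ ⟨c⟩; exact Quot.sound (Rel.leibniz a b c)

instance instPoissonAlgebra : PoissonAlgebra k (FreeMP k X) where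
  __ := instModule k X
  lie_smul := by rintro t ⟨a⟩ ⟨b⟩; exact Quot.sound (Rel.lie_smul t a b)
  smul_mul := by rintro t ⟨a⟩ ⟨b⟩; exact Quot.sound (Rel.smul_mul t a b)

/-- The free generator (letter) of `MP_k(X)` attached to `x : X`. -/
def letter {X : Type v} (x : X) : FreeMP k X := Quot.mk _ (Pre.of x)

variable {k X}

/-- Induction on the formation of elements of `MP_k(X)`. -/
theorem induction_on {C : FreeMP k X → Prop} (a : FreeMP k X)
    (h_letter : ∀ x, C (letter k x)) (h_zero : C 0)
    (h_add : ∀ a b, C a → C b → C (a + b)) (h_smul : ∀ (t : k) a, C a → C (t • a))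
    (h_mul : ∀ a b, C a → C b → C (a * b)) (h_lie : ∀ a b, C a → C b → C ⁅a, b⁆) : C a := by
  obtain ⟨a⟩ := a
  induction a with
  | of x => exact h_letter x
  | zero => exact h_zero
  | add a b ha hb => exact h_add _ _ ha hb
  | smul t a ha => exact h_smul t _ ha
  | mul a b ha hb => exact h_mul _ _ ha hb
  | lie a b ha hb => exact h_lie _ _ ha hb

/-- The span of all products and brackets. -/
def square (k : Type u) (X : Type v) [Field k] : Submodule k (FreeMP k X) :=
  Submodule.span k {w | ∃ a b : FreeMP k X, w = a * b ∨ w = ⁅a, b⁆}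

theorem mul_mem_square (a b : FreeMP k X) : a * b ∈ square k X :=
  Submodule.subset_span ⟨a, b, Or.inl rfl⟩

theorem lie_mem_square (a b : FreeMP k X) : ⁅a, b⁆ ∈ square k X :=
  Submodule.subset_span ⟨a, b, Or.inr rfl⟩

theorem smul_mul' (t : k) (a b : FreeMP k X) : (t • a) * b = t • (a * b) :=
  PoissonAlgebra.smul_mul t a b

theorem mul_smul' (t : k) (a b : FreeMP k X) : a * (t • b) = t • (a * b) := by
  rw [mul_comm, smul_mul', mul_comm]

theorem square_square {x y : FreeMP k X} (hx : x ∈ square k X) (hy : y ∈ square k X) :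
    x * y = 0 ∧ ⁅x, y⁆ = 0 := by
  induction hx using Submodule.span_induction with
  | mem x hx =>
    induction hy using Submodule.span_induction with
    | mem y hy =>
      obtain ⟨⟨a⟩, ⟨b⟩, rfl | rfl⟩ := hx <;> obtain ⟨⟨c⟩, ⟨d⟩, rfl | rfl⟩ := hy
      · exact ⟨Quot.sound (Rel.mul_mul_mul a b c d), Quot.sound (Rel.lie_mul_mul a b c d)⟩
      · exact ⟨Quot.sound (Rel.mul_mul_lie a b c d), Quot.sound (Rel.lie_mul_lie a b c d)⟩
      · constructor
        · rw [mul_comm]; exact Quot.sound (Rel.mul_mul_lie c d a b)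
        · rw [← lie_skew, neg_eq_zero]; exact Quot.sound (Rel.lie_mul_lie c d a b)
      · exact ⟨Quot.sound (Rel.mul_lie_lie a b c d), Quot.sound (Rel.lie_lie_lie a b c d)⟩
    | zero => simp
    | add y z _ _ hy hz => simp [mul_add, hy, hz]
    | smul t y _ hy => simp [mul_smul', hy]
  | zero => simp
  | add x z _ _ hx hz => simp [add_mul, hx, hz]
  | smul t x _ hx => simp [smul_mul', hx]

theorem isMetabelianPoisson : IsMetabelianPoisson k (FreeMP k X) :=
  ⟨square k X, fun x _ p => ⟨mul_mem_square x p, lie_mem_square x p⟩,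
    fun _ hx _ hy => square_square hx hy, fun x y => ⟨mul_mem_square x y, lie_mem_square x y⟩⟩

end Structure

/-! ### The universal property -/

section Lift

variable {k : Type u} {X : Type v} [Field k] {Q : Type w} [PoissonRing Q] [PoissonAlgebra k Q]

/-- Evaluation of a formal expression. -/
def Pre.eval (f : X → Q) : Pre k X → Q
  | .of x => f x
  | .zero => 0
  | .add a b => a.eval f + b.eval f
  | .smul t a => t • a.eval f
  | .mul a b => a.eval f * b.eval f
  | .lie a b => ⁅a.eval f, b.eval f⁆

theorem Rel.eval_eq (hQ : IsMetabelianPoisson k Q) (f : X → Q) {a b : Pre k X}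
    (h : Rel k X a b) : a.eval f = b.eval f := by
  obtain ⟨I, -, h0, hI⟩ := hQ
  have M := fun x y : Q => (hI x y).1
  have L := fun x y : Q => (hI x y).2
  induction h with
  | add_left c _ ih => simp only [Pre.eval, ih]
  | add_right c _ ih => simp only [Pre.eval, ih]
  | smul_congr t _ ih => simp only [Pre.eval, ih]
  | mul_left c _ ih => simp only [Pre.eval, ih]
  | mul_right c _ ih => simp only [Pre.eval, ih]
  | lie_left c _ ih => simp only [Pre.eval, ih]
  | lie_right c _ ih => simp only [Pre.eval, ih]
  | add_assoc a b c => exact _root_.add_assoc _ _ _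
  | add_comm a b => exact _root_.add_comm _ _
  | zero_add a => exact _root_.zero_add _
  | smul_add t a b => exact _root_.smul_add _ _ _
  | add_smul s t a => exact _root_.add_smul _ _ _
  | mul_smul s t a => exact SemigroupAction.mul_smul _ _ _
  | one_smul a => exact _root_.one_smul _ _
  | zero_smul a => exact _root_.zero_smul _ _
  | add_mul a b c => exact _root_.add_mul _ _ _
  | smul_mul t a b => exact PoissonAlgebra.smul_mul _ _ _
  | mul_comm a b => exact _root_.mul_comm _ _
  | mul_assoc a b c => exact _root_.mul_assoc _ _ _
  | add_lie a b c => exact _root_.add_lie _ _ _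
  | lie_add a b c => exact _root_.lie_add _ _ _
  | lie_smul t a b => exact _root_.lie_smul _ _ _
  | lie_self a => exact _root_.lie_self _
  | jacobi a b c => exact _root_.leibniz_lie _ _ _
  | leibniz a b c => exact PoissonRing.leibniz _ _ _
  | mul_mul_mul a b c d => exact (h0 _ (M _ _) _ (M _ _)).1
  | mul_mul_lie a b c d => exact (h0 _ (M _ _) _ (L _ _)).1
  | mul_lie_lie a b c d => exact (h0 _ (L _ _) _ (L _ _)).1
  | lie_mul_mul a b c d => exact (h0 _ (M _ _) _ (M _ _)).2
  | lie_mul_lie a b c d => exact (h0 _ (M _ _) _ (L _ _)).2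
  | lie_lie_lie a b c d => exact (h0 _ (L _ _) _ (L _ _)).2

/-- The homomorphism from `MP_k(X)` to a metabelian Poisson algebra induced by the images of the
letters. -/
def lift (hQ : IsMetabelianPoisson k Q) (f : X → Q) : PoissonHom k (FreeMP k X) Q where
  toFun := Quot.lift (Pre.eval f) (fun _ _ h => h.eval_eq hQ f)
  map_add' := by rintro ⟨a⟩ ⟨b⟩; rfl
  map_smul' := by rintro t ⟨a⟩; rfl
  map_mul := by rintro ⟨a⟩ ⟨b⟩; rfl
  map_lie := by rintro ⟨a⟩ ⟨b⟩; rfl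

theorem lift_letter (hQ : IsMetabelianPoisson k Q) (f : X → Q) (x : X) :
    lift hQ f (letter k x) = f x := rfl

theorem hom_ext {φ ψ : PoissonHom k (FreeMP k X) Q}
    (h : ∀ x, φ (letter k x) = ψ (letter k x)) (a : FreeMP k X) : φ a = ψ a := by
  induction a using induction_on with
  | h_letter x => exact h x
  | h_zero => exact (φ.toLinearMap.map_zero).trans (ψ.toLinearMap.map_zero).symm
  | h_add a b ha hb => rw [φ.map_add', ψ.map_add', ha, hb]
  | h_smul t a ha => rw [φ.map_smul', ψ.map_smul', ha]
  | h_mul a b ha hb => rw [φ.map_mul, ψ.map_mul, ha, hb]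
  | h_lie a b ha hb => rw [φ.map_lie, ψ.map_lie, ha, hb]

end Lift

/-! ### Monomials, length and the linear part -/

section Linear

variable (k : Type u) (X : Type v) [Field k]

/-- `IsMonomial k X n W`: `W` is (the value of) a monomial of length `n`, that is, it is formed
from `n` letters, counted with repetitions, by products and brackets. -/
inductive IsMonomial : ℕ → FreeMP k X → Prop
  | letter (x : X) : IsMonomial 1 (letter k x)
  | mul {m n : ℕ} {V W : FreeMP k X} :
      IsMonomial m V → IsMonomial n W → IsMonomial (m + n) (V * W)
  | lie {m n : ℕ} {V W : FreeMP k X} :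
      IsMonomial m V → IsMonomial n W → IsMonomial (m + n) ⁅V, W⁆

/-- The subspace `kX` spanned by the letters. -/
def linearSpan : Submodule k (FreeMP k X) := Submodule.span k (Set.range (letter k))

/-- The subspace spanned by the monomials of length at least two. -/
def nonlinearSpan : Submodule k (FreeMP k X) :=
  Submodule.span k {W | ∃ n, 2 ≤ n ∧ IsMonomial k X n W}

variable {k X}

/-- Coefficients of the letters in a formal expression. -/
noncomputable def Pre.coeff : Pre k X → (X →₀ k)
  | .of x => Finsupp.single x 1
  | .zero => 0
  | .add a b => a.coeff + b.coeff
  | .smul t a => t • a.coeff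
  | .mul _ _ => 0
  | .lie _ _ => 0

theorem Rel.coeff_eq {a b : Pre k X} (h : Rel k X a b) : a.coeff = b.coeff := by
  induction h with
  | add_assoc a b c => exact _root_.add_assoc _ _ _
  | add_comm a b => exact _root_.add_comm _ _
  | smul_add t a b => exact _root_.smul_add _ _ _
  | add_smul s t a => exact _root_.add_smul _ _ _
  | mul_smul s t a => exact SemigroupAction.mul_smul _ _ _
  | _ => simp_all [Pre.coeff]

/-- Coefficients of the letters, as a linear map. -/
noncomputable def coeff : FreeMP k X →ₗ[k] (X →₀ k) where
  toFun := Quot.lift Pre.coeff (fun _ _ h => h.coeff_eq)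
  map_add' := by rintro ⟨a⟩ ⟨b⟩; rfl
  map_smul' := by rintro t ⟨a⟩; rfl

theorem coeff_letter (x : X) : coeff (letter k x) = Finsupp.single x 1 := rfl

theorem coeff_mul (a b : FreeMP k X) : coeff (a * b) = 0 := by
  obtain ⟨a⟩ := a; obtain ⟨b⟩ := b; rfl

theorem coeff_lie (a b : FreeMP k X) : coeff ⁅a, b⁆ = 0 := by
  obtain ⟨a⟩ := a; obtain ⟨b⟩ := b; rfl

theorem linearIndependent_letter : LinearIndependent k (letter k : X → FreeMP k X) := by
  refine LinearIndependent.of_comp coeff ?_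
  have h : (coeff ∘ letter k : X → X →₀ k) = fun x => Finsupp.single x 1 :=
    funext coeff_letter
  simpa [h] using (Finsupp.basisSingleOne (R := k) (ι := X)).linearIndependent

variable (k X) in
/-- The letters, as a basis of `kX`. -/
noncomputable def letterBasis : Module.Basis X k (linearSpan k X) :=
  Module.Basis.span linearIndependent_letter

theorem letterBasis_apply (x : X) : (letterBasis k X x : FreeMP k X) = letter k x :=
  congrArg Subtype.val (Module.Basis.span_apply _ x)

theorem IsMonomial.pos {n : ℕ} {W : FreeMP k X} (h : IsMonomial k X n W) : 1 ≤ n := by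
  induction h with
  | letter => exact le_rfl
  | mul => omega
  | lie => omega

theorem IsMonomial.coeff_eq_zero {n : ℕ} {W : FreeMP k X} (h : IsMonomial k X n W)
    (hn : 2 ≤ n) : coeff W = 0 := by
  cases h with
  | letter => omega
  | mul => exact coeff_mul _ _
  | lie => exact coeff_lie _ _

theorem coeff_eq_zero_of_mem {a : FreeMP k X} (h : a ∈ nonlinearSpan k X) : coeff a = 0 := by
  have : nonlinearSpan k X ≤ LinearMap.ker (coeff (k := k) (X := X)) := by
    refine Submodule.span_le.mpr ?_
    rintro W ⟨n, hn, hW⟩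
    exact hW.coeff_eq_zero hn
  exact this h

/-- Every element is a linear combination of monomials. -/
theorem span_monomial (a : FreeMP k X) :
    a ∈ Submodule.span k {W | ∃ n, IsMonomial k X n W} := by
  have key (op : FreeMP k X →ₗ[k] FreeMP k X →ₗ[k] FreeMP k X)
      (hop : ∀ m n V W, IsMonomial k X m V → IsMonomial k X n W → ∃ p, IsMonomial k X p (op V W))
      (a b : FreeMP k X) (ha : a ∈ Submodule.span k {W | ∃ n, IsMonomial k X n W})
      (hb : b ∈ Submodule.span k {W | ∃ n, IsMonomial k X n W}) :
      op a b ∈ Submodule.span k {W | ∃ n, IsMonomial k X n W} := by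
    have h := Submodule.apply_mem_map₂ op ha hb
    rw [Submodule.map₂_span_span] at h
    refine Submodule.span_mono ?_ h
    rintro _ ⟨V, ⟨m, hV⟩, W, ⟨n, hW⟩, rfl⟩
    exact hop m n V W hV hW
  induction a using induction_on with
  | h_letter x => exact Submodule.subset_span ⟨1, .letter x⟩
  | h_zero => exact Submodule.zero_mem _
  | h_add a b ha hb => exact Submodule.add_mem _ ha hb
  | h_smul t a ha => exact Submodule.smul_mem _ t ha
  | h_mul a b ha hb =>
    exact key (LinearMap.mk₂ k (· * ·) add_mul smul_mul' mul_add mul_smul')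
      (fun m n _ _ hV hW => ⟨m + n, hV.mul hW⟩) a b ha hb
  | h_lie a b ha hb =>
    exact key (LinearMap.mk₂ k (fun a b => ⁅a, b⁆) add_lie smul_lie lie_add lie_smul)
      (fun m n _ _ hV hW => ⟨m + n, hV.lie hW⟩) a b ha hb

/-- `MP_k(X)` is the direct sum of `kX` and the span of the monomials of length at least two. -/
theorem isCompl_linearSpan : IsCompl (linearSpan k X) (nonlinearSpan k X) := by
  constructor
  · rw [Submodule.disjoint_def]
    intro a ha hb
    have h0 := coeff_eq_zero_of_mem hb
    have hinj : (coeff ∘ₗ (linearSpan k X).subtype) ∘ₗ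
        (letterBasis k X).repr.symm.toLinearMap = LinearMap.id := by
      ext x : 1
      ext1
      simp [letterBasis_apply, coeff_letter]
    have h1 := LinearMap.congr_fun hinj ((letterBasis k X).repr ⟨a, ha⟩)
    simpa [h0] using h1.symm
  · rw [codisjoint_iff, eq_top_iff]
    intro a _
    refine (Submodule.span_le.mpr ?_ : Submodule.span k _ ≤ _) (span_monomial a)
    rintro W ⟨n, hW⟩
    rcases hW.pos.eq_or_lt with h | h
    · refine Submodule.mem_sup_left ?_
      cases hW with
      | letter x => exact Submodule.subset_span ⟨x, rfl⟩
      | mul hV hW => have := hV.pos; have := hW.pos; omega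
      | lie hV hW => have := hV.pos; have := hW.pos; omega
    · exact Submodule.mem_sup_right (Submodule.subset_span ⟨n, h, hW⟩)

/-- The linear part `f⁽¹⁾` of `f`: the sum of its terms of length one. -/
noncomputable def linearPart : FreeMP k X →ₗ[k] linearSpan k X :=
  (linearSpan k X).projectionOnto (nonlinearSpan k X) isCompl_linearSpan

/-- The nonlinear part `f⁽²⁾` of `f`: the sum of its terms of length at least two. -/
noncomputable def nonlinearPart : FreeMP k X →ₗ[k] nonlinearSpan k X :=
  (nonlinearSpan k X).projectionOnto (linearSpan k X) isCompl_linearSpan.symm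

theorem linearPart_add_nonlinearPart (f : FreeMP k X) :
    (linearPart f : FreeMP k X) + nonlinearPart f = f := by
  have h := Submodule.projection_add_projection_eq_self (isCompl_linearSpan (k := k) (X := X)) f
  simpa [linearPart, nonlinearPart] using h

/-- The endomorphism `φ̃` of `kX` sending each letter `b` to the linear part of `φ(b)`. -/
noncomputable def inducedLinear (φ : PoissonHom k (FreeMP k X) (FreeMP k X)) :
    linearSpan k X →ₗ[k] linearSpan k X :=
  (letterBasis k X).constr k (fun b => linearPart (φ (letter k b)))

end Linear

/-! ### Finite descriptions of endomorphisms -/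

section Coding

/-- A formal polynomial, as a finite list of terms. The term `(t, a, [a₂, …, aₘ], [c₁, …, cₛ])`
stands for `t · [a, a₂, …, aₘ] · c₁ ⋯ cₛ`, with a scalar `t`, a left-normed bracket
`[a, a₂, …, aₘ] = ⁅…⁅⁅a, a₂⁆, a₃⁆…, aₘ⁆`, and letters named by natural numbers. -/
abbrev FormalPoly (k : Type u) : Type u := List (k × ℕ × List ℕ × List ℕ)

variable {k : Type u} [Field k]

/-- The letter with number `i`; numbers that name no letter are read as zero. -/
def letterNat (k : Type u) [Field k] (n i : ℕ) : FreeMP k (Fin n) :=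
  if h : i < n then letter k ⟨i, h⟩ else 0

/-- The value of the monomial `[a, a₂, …, aₘ] · c₁ ⋯ cₛ`. -/
def evalMonomial (k : Type u) [Field k] (n : ℕ) (a : ℕ) (l c : List ℕ) : FreeMP k (Fin n) :=
  c.foldl (fun W i => W * letterNat k n i)
    (l.foldl (fun W i => ⁅W, letterNat k n i⁆) (letterNat k n a))

/-- The element of `MP_k(b₁, …, bₙ)` described by a formal polynomial. -/
def evalPoly (n : ℕ) (p : FormalPoly k) : FreeMP k (Fin n) :=
  (p.map (fun t => t.1 • evalMonomial k n t.2.1 t.2.2.1 t.2.2.2)).sum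

/-- The elements described by formal polynomials form a subspace. -/
def describable (k : Type u) [Field k] (n : ℕ) : Submodule k (FreeMP k (Fin n)) where
  carrier := {f | ∃ p : FormalPoly k, evalPoly n p = f}
  zero_mem' := ⟨[], rfl⟩
  add_mem' := by
    rintro _ _ ⟨p, rfl⟩ ⟨q, rfl⟩
    exact ⟨p ++ q, by simp [evalPoly]⟩
  smul_mem' := by
    rintro t _ ⟨p, rfl⟩
    refine ⟨p.map (fun s => (t * s.1, s.2)), ?_⟩
    simp [evalPoly, List.smul_sum, SemigroupAction.mul_smul, Function.comp_def]

theorem evalMonomial_mem (n a : ℕ) (l c : List ℕ) :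
    evalMonomial k n a l c ∈ describable k n :=
  ⟨[(1, a, l, c)], by simp [evalPoly]⟩

theorem describable_le (n : ℕ) : describable k n ≤
    Submodule.span k {W | ∃ a l c, W = evalMonomial k n a l c} := by
  rintro _ ⟨p, rfl⟩
  refine list_sum_mem ?_
  intro W hW
  obtain ⟨t, -, rfl⟩ := List.mem_map.mp hW
  exact Submodule.smul_mem _ _ (Submodule.subset_span ⟨_, _, _, rfl⟩)

theorem mul_letterNat_mem {n : ℕ} (i : ℕ) {W : FreeMP k (Fin n)} (hW : W ∈ describable k n) :
    W * letterNat k n i ∈ describable k n := by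
  have h := describable_le n hW
  induction h using Submodule.span_induction with
  | mem W h =>
    obtain ⟨a, l, c, rfl⟩ := h
    have h := evalMonomial_mem (k := k) n a l (c ++ [i])
    simpa [evalMonomial] using h
  | zero => simp
  | add x y hx hy h1 h2 =>
    have hle : ∀ z ∈ Submodule.span k {W | ∃ a l c, W = evalMonomial k n a l c},
        z ∈ describable k n := fun z hz => (Submodule.span_le.mpr (by
          rintro _ ⟨a, l, c, rfl⟩; exact evalMonomial_mem n a l c)) hz
    rw [add_mul]
    exact Submodule.add_mem _ (h1 (hle x hx)) (h2 (hle y hy))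
  | smul t x hx h1 =>
    have hle : ∀ z ∈ Submodule.span k {W | ∃ a l c, W = evalMonomial k n a l c},
        z ∈ describable k n := fun z hz => (Submodule.span_le.mpr (by
          rintro _ ⟨a, l, c, rfl⟩; exact evalMonomial_mem n a l c)) hz
    rw [smul_mul']
    exact Submodule.smul_mem _ _ (h1 (hle x hx))

theorem evalMonomial_cases (n a : ℕ) (l c : List ℕ) :
    (evalMonomial k n a l c = letterNat k n a) ∨ evalMonomial k n a l c ∈ square k (Fin n) := by
  rcases c.eq_nil_or_concat' with rfl | ⟨c, i, rfl⟩
  · rcases l.eq_nil_or_concat' with rfl | ⟨l, i, rfl⟩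
    · exact Or.inl rfl
    · exact Or.inr (by simpa [evalMonomial] using lie_mem_square _ _)
  · exact Or.inr (by simpa [evalMonomial] using mul_mem_square _ _)

theorem lie_letterNat_mem (n j a : ℕ) (l c : List ℕ) :
    ⁅evalMonomial k n a l c, letterNat k n j⁆ ∈ describable k n := by
  induction c using List.reverseRecOn with
  | nil =>
    have h := evalMonomial_mem (k := k) n a (l ++ [j]) []
    simpa [evalMonomial] using h
  | append_singleton c i ih =>
    have e : evalMonomial k n a l (c ++ [i]) = evalMonomial k n a l c * letterNat k n i := by
      simp [evalMonomial]
    have e2 : ⁅evalMonomial k n a l c * letterNat k n i, letterNat k n j⁆ =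
        ⁅evalMonomial k n a l c, letterNat k n j⁆ * letterNat k n i +
          evalMonomial k n a l c * ⁅letterNat k n i, letterNat k n j⁆ := by
      rw [← lie_skew, PoissonRing.leibniz, neg_add, ← neg_mul, ← mul_neg, lie_skew, lie_skew]
    rw [e, e2]
    refine Submodule.add_mem _ (mul_letterNat_mem i ih) ?_
    rcases evalMonomial_cases (k := k) n a l c with h | h
    · rw [h, mul_comm]
      exact evalMonomial_mem n i [j] [a]
    · rw [(square_square h (lie_mem_square _ _)).1]
      exact Submodule.zero_mem _

/-- Every element of `MP_k(b₁, …, bₙ)` is described by some formal polynomial. -/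
theorem evalPoly_surjective (n : ℕ) :
    Function.Surjective (evalPoly n : FormalPoly k → FreeMP k (Fin n)) := by
  have key (op : FreeMP k (Fin n) →ₗ[k] FreeMP k (Fin n) →ₗ[k] FreeMP k (Fin n))
      (hop : ∀ a l c a' l' c', op (evalMonomial k n a l c) (evalMonomial k n a' l' c') ∈
        describable k n)
      (x y : FreeMP k (Fin n)) (hx : x ∈ describable k n) (hy : y ∈ describable k n) :
      op x y ∈ describable k n := by
    have h := Submodule.apply_mem_map₂ op (describable_le n hx) (describable_le n hy)
    rw [Submodule.map₂_span_span] at h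
    refine (Submodule.span_le.mpr ?_ : Submodule.span k _ ≤ _) h
    rintro _ ⟨_, ⟨a, l, c, rfl⟩, _, ⟨a', l', c', rfl⟩, rfl⟩
    exact hop a l c a' l' c'
  intro f
  suffices h : f ∈ describable k n from h
  induction f using induction_on with
  | h_letter x =>
    have h := evalMonomial_mem (k := k) n x [] []
    simpa [evalMonomial, letterNat] using h
  | h_zero => exact Submodule.zero_mem _
  | h_add a b ha hb => exact Submodule.add_mem _ ha hb
  | h_smul t a ha => exact Submodule.smul_mem _ t ha
  | h_mul x y hx hy =>
    refine key (LinearMap.mk₂ k (· * ·) add_mul smul_mul' mul_add mul_smul') ?_ x y hx hy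
    intro a l c a' l' c'
    rw [LinearMap.mk₂_apply]
    rcases evalMonomial_cases (k := k) n a' l' c' with h | h
    · rw [h]; exact mul_letterNat_mem _ (evalMonomial_mem n a l c)
    · rcases evalMonomial_cases (k := k) n a l c with h' | h'
      · rw [h', mul_comm]; exact mul_letterNat_mem _ (evalMonomial_mem n a' l' c')
      · rw [(square_square h' h).1]; exact Submodule.zero_mem _
  | h_lie x y hx hy =>
    refine key (LinearMap.mk₂ k (fun a b => ⁅a, b⁆) add_lie smul_lie lie_add lie_smul) ?_ x y hx hy
    intro a l c a' l' c'
    rw [LinearMap.mk₂_apply]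
    rcases evalMonomial_cases (k := k) n a' l' c' with h | h
    · rw [h]; exact lie_letterNat_mem n a' a l c
    · rcases evalMonomial_cases (k := k) n a l c with h' | h'
      · rw [h', ← lie_skew]
        exact Submodule.neg_mem _ (lie_letterNat_mem n a a' l' c')
      · rw [(square_square h' h).2]; exact Submodule.zero_mem _

/-- The endomorphism of `MP_k(b₁, …, bₙ)` described by a list of `n` formal polynomials,
the images of the letters. -/
def endOfList (L : List (FormalPoly k)) :
    PoissonHom k (FreeMP k (Fin L.length)) (FreeMP k (Fin L.length)) :=
  lift isMetabelianPoisson (fun i => evalPoly L.length (L.get i))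

end Coding

end FreeMP

/-- A computable field: its elements are coded effectively (as a `Primcodable` type, so that
equality is decidable) and there are algorithms for the field operations. -/
structure IsComputableField (k : Type u) [Field k] [Primcodable k] : Prop where
  add : Computable₂ (fun x y : k => x + y)
  mul : Computable₂ (fun x y : k => x * y)
  neg : Computable (fun x : k => -x)
  inv : Computable (fun x : k => x⁻¹)

/-! ## Basic facts on Poisson homomorphisms -/

namespace PoissonHom

variable {k : Type u} {P : Type v} {Q : Type w} [Field k] [PoissonRing P] [PoissonAlgebra k P]
  [PoissonRing Q] [PoissonAlgebra k Q] (φ : PoissonHom k P Q)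

/-! Write P for the algebra and P² for the span of all products and brackets (`square`). P²
coincides with the nonlinear part, and both operations vanish on it. Hence the operators "bracket
with a letter" commute on P², which makes P² a module over the polynomial ring k[X]. Since w·x·y = 0
for w in P², finitely many words of length two and three generate this module, so it is Noetherian.
The kernels of the powers of a surjective endomorphism φ therefore stabilize inside P², and P is
Hopfian (`bijective_of_surjective`). Only surjectivity has to be characterized.

Criterion. If φ is onto, P² is spanned by images of monomials of length at least two, and all of
these lie in Id(S). Conversely, if φ̃ is onto, then the range of φ together with P² spans P. As P²
acts on itself by zero, the part of the range inside P² is a Poisson ideal. It contains S, hence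
every nonlinear part of an image of a letter, so the range contains the linear parts and thus all
letters.

Decidability. The Magnus homomorphism kills products and attaches to each element a vector of Fox
derivatives over k[X]. The chain rule shows that the Jacobian matrix of a surjective φ is
invertible. Conversely, an invertible Jacobian forces surjectivity
(`surjective_of_isUnit_det_jacobian`): Fox derivatives control brackets modulo products, and
products are then recovered from w·x·y = 0. So φ is an automorphism exactly when its Jacobian
determinant is a nonzero constant. Expanding that determinant in an exterior algebra turns this into
a finite test on lists of coefficients (`isUnitTest`). -/

theorem apply_sub (x y : P) : φ (x - y) = φ x - φ y := φ.toLinearMap.map_sub x y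

theorem apply_zero : φ (0 : P) = 0 := φ.toLinearMap.map_zero

end PoissonHom

namespace FreeMP

variable {k : Type u} {X : Type v} [Field k]

/-! ## Products and brackets as the commutator part -/

theorem nonlinearSpan_le_square : nonlinearSpan k X ≤ square k X := by
  refine Submodule.span_le.mpr ?_
  rintro W ⟨n, hn, hW⟩
  cases hW with
  | letter x => omega
  | mul => exact mul_mem_square _ _
  | lie => exact lie_mem_square _ _

theorem coeff_eq_zero_of_mem_square {f : FreeMP k X} (hf : f ∈ square k X) : coeff f = 0 := by
  have : square k X ≤ LinearMap.ker (coeff (k := k) (X := X)) := by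
    refine Submodule.span_le.mpr ?_
    rintro W ⟨a, b, rfl | rfl⟩
    · exact coeff_mul a b
    · exact coeff_lie a b
  exact this hf

theorem coeff_letterBasis_symm (c : X →₀ k) :
    coeff ((letterBasis k X).repr.symm c : FreeMP k X) = c := by
  have h : (coeff ∘ₗ (linearSpan k X).subtype) ∘ₗ
      (letterBasis k X).repr.symm.toLinearMap = LinearMap.id := by
    ext x : 1
    ext1
    simp [letterBasis_apply, coeff_letter]
  exact LinearMap.congr_fun h c

theorem linearSpan_coeff_injective {f : FreeMP k X} (hf : f ∈ linearSpan k X)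
    (h : coeff f = 0) : f = 0 := by
  have h1 := coeff_letterBasis_symm ((letterBasis k X).repr ⟨f, hf⟩)
  rw [LinearEquiv.symm_apply_apply] at h1
  have h2 : (letterBasis k X).repr ⟨f, hf⟩ = 0 := h1.symm.trans h
  simpa using congrArg Subtype.val ((letterBasis k X).repr.map_eq_zero_iff.mp h2)

/-- The letter coefficients vanish on products and brackets and are faithful on kX. An element of
the square therefore has zero linear part, with no need to expand its factors into monomials. -/
theorem nonlinearSpan_eq_square : nonlinearSpan k X = square k X := by
  refine le_antisymm nonlinearSpan_le_square fun f hf => ?_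
  have h := linearPart_add_nonlinearPart f
  have h0 : (linearPart f : FreeMP k X) = 0 := by
    refine linearSpan_coeff_injective (linearPart f).2 ?_
    have := congrArg coeff h
    rwa [map_add, coeff_eq_zero_of_mem (nonlinearPart f).2, add_zero,
      coeff_eq_zero_of_mem_square hf] at this
  rw [← h, h0, zero_add]
  exact (nonlinearPart f).2

theorem sub_linearPart_mem_square (f : FreeMP k X) :
    f - (linearPart f : FreeMP k X) ∈ square k X := by
  rw [← nonlinearSpan_eq_square]
  nth_rw 1 [← linearPart_add_nonlinearPart f]
  rw [add_sub_cancel_left]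
  exact (nonlinearPart f).2

theorem linearPart_eq_zero_iff {f : FreeMP k X} : linearPart f = 0 ↔ f ∈ square k X := by
  rw [← nonlinearSpan_eq_square]
  exact Submodule.projectionOnto_apply_eq_zero_iff _

theorem mem_square_iff {f : FreeMP k X} : f ∈ square k X ↔ coeff f = 0 := by
  refine ⟨coeff_eq_zero_of_mem_square, fun h => ?_⟩
  rw [← linearPart_eq_zero_iff]
  refine Subtype.ext (linearSpan_coeff_injective (linearPart f).2 ?_)
  have h1 := coeff_eq_zero_of_mem_square (sub_linearPart_mem_square f)
  rwa [map_sub, h, zero_sub, neg_eq_zero] at h1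

/-- Jacobi identity: the defect is `⁅w, ⁅x, y⁆⁆`, a bracket of two elements of the abelian square.
-/
theorem lie_lie_comm {w : FreeMP k X} (hw : w ∈ square k X) (x y : FreeMP k X) :
    ⁅⁅w, x⁆, y⁆ = ⁅⁅w, y⁆, x⁆ := by
  have h := leibniz_lie w x y
  rw [(square_square hw (lie_mem_square x y)).2] at h
  rw [← lie_skew x ⁅w, y⁆] at h
  exact eq_of_sub_eq_zero (by rw [sub_eq_add_neg]; exact h.symm)

theorem square_mul_mul {w : FreeMP k X} (hw : w ∈ square k X) (x y : FreeMP k X) :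
    w * x * y = 0 := by
  rw [mul_assoc]
  exact (square_square hw (mul_mem_square x y)).1

/-- In the Leibniz expansion the term with `⁅y, x⁆` is a product of two elements of the square. -/
theorem square_mul_lie {w : FreeMP k X} (hw : w ∈ square k X) (x y : FreeMP k X) :
    ⁅w * x, y⁆ = ⁅w, y⁆ * x := by
  rw [← lie_skew, PoissonRing.leibniz, mul_comm w ⁅y, x⁆,
    mul_comm ⁅y, x⁆ w, (square_square hw (lie_mem_square y x)).1, add_zero, ← neg_mul, lie_skew]

theorem apply_mem_square (φ : PoissonHom k (FreeMP k X) (FreeMP k X)) {w : FreeMP k X}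
    (hw : w ∈ square k X) : φ w ∈ square k X := by
  have : square k X ≤ (square k X).comap φ.toLinearMap := by
    refine Submodule.span_le.mpr ?_
    rintro W ⟨a, b, rfl | rfl⟩
    · have h := mul_mem_square (φ a) (φ b)
      rwa [← φ.map_mul] at h
    · have h := lie_mem_square (φ a) (φ b)
      rwa [← φ.map_lie] at h
  exact this hw

/-- An endomorphism preserves the square, so it induces a map on the quotient by the square; that
map is φ̃ once the quotient is identified with kX. -/
theorem inducedLinear_linearPart (φ : PoissonHom k (FreeMP k X) (FreeMP k X))
    (f : FreeMP k X) : inducedLinear φ (linearPart f) = linearPart (φ f) := by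
  have h1 : inducedLinear φ = linearPart ∘ₗ φ.toLinearMap ∘ₗ (linearSpan k X).subtype := by
    refine (letterBasis k X).ext fun x => ?_
    rw [inducedLinear, Module.Basis.constr_basis]
    simp only [LinearMap.comp_apply, Submodule.subtype_apply, letterBasis_apply]
    rfl
  rw [h1]
  have h2 := linearPart_eq_zero_iff.mpr (apply_mem_square φ (sub_linearPart_mem_square f))
  rw [φ.apply_sub, map_sub, sub_eq_zero] at h2
  exact h2.symm

/-! ## The action of polynomials on the square -/

/-- Bracketing with a letter, as an operator on the square. -/
def adLetter (x : X) : Module.End k (square k X) where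
  toFun w := ⟨⁅(w : FreeMP k X), letter k x⁆, lie_mem_square _ _⟩
  map_add' _ _ := Subtype.ext (add_lie _ _ _)
  map_smul' _ _ := Subtype.ext (smul_lie _ _ _)

theorem adLetter_commute (x y : X) :
    adLetter (k := k) x * adLetter y = adLetter y * adLetter x := by
  ext w
  exact lie_lie_comm w.2 _ _

open scoped IsMulCommutative in
/-- Polynomials can be evaluated at commuting elements of a noncommutative algebra. -/
theorem exists_aeval_of_commute {E : Type*} [Ring E] [Algebra k E] (f : X → E)
    (hf : ∀ x y, f x * f y = f y * f x) :
    ∃ ρ : MvPolynomial X k →ₐ[k] E, ∀ x, ρ (MvPolynomial.X x) = f x := by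
  have := Algebra.isMulCommutative_adjoin k (s := Set.range f) (by
    rintro _ ⟨x, rfl⟩ _ ⟨y, rfl⟩
    exact hf x y)
  refine ⟨(Algebra.adjoin k (Set.range f)).val.comp
    (MvPolynomial.aeval (S₁ := Algebra.adjoin k (Set.range f))
      (fun x => ⟨f x, Algebra.subset_adjoin ⟨x, rfl⟩⟩)), fun x => ?_⟩
  rw [AlgHom.comp_apply, MvPolynomial.aeval_X]
  rfl

/-- Polynomials act on the square, the variable `x` by the bracket with the letter `x`. -/
noncomputable def squareRep : MvPolynomial X k →ₐ[k] Module.End k (square k X) :=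
  (exists_aeval_of_commute adLetter adLetter_commute).choose

theorem squareRep_X (x : X) (w : square k X) :
    (squareRep (MvPolynomial.X x) w : FreeMP k X) = ⁅(w : FreeMP k X), letter k x⁆ := by
  rw [squareRep, (exists_aeval_of_commute adLetter adLetter_commute).choose_spec x]
  rfl

theorem squareRep_C (c : k) (w : square k X) : squareRep (MvPolynomial.C c) w = c • w := by
  rw [← MvPolynomial.algebraMap_eq, AlgHom.commutes, Module.algebraMap_end_apply]

/-- A subspace closed under the brackets with letters is closed under the polynomial action. -/
theorem squareRep_mem {U : Submodule k (FreeMP k X)}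
    (hU : ∀ w ∈ U, ∀ x : X, ⁅w, letter k x⁆ ∈ U) (a : MvPolynomial X k) (w : square k X)
    (hw : (w : FreeMP k X) ∈ U) : (squareRep a w : FreeMP k X) ∈ U := by
  induction a using MvPolynomial.induction_on generalizing w with
  | C c => rw [squareRep_C]; exact U.smul_mem c hw
  | add p q hp hq =>
    rw [map_add, LinearMap.add_apply]
    exact U.add_mem (hp w hw) (hq w hw)
  | mul_X p x hp =>
    rw [map_mul, Module.End.mul_apply]
    refine hp _ ?_
    rw [squareRep_X]
    exact hU _ hw x

/-- Multiplication by any element commutes with the polynomial action, by `square_mul_lie`. Closure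
of a submodule under products can thus be checked on generators. -/
theorem squareRep_mul_letter (a : MvPolynomial X k) (w : square k X) (y : FreeMP k X) :
    (squareRep a w : FreeMP k X) * y =
      squareRep a ⟨(w : FreeMP k X) * y, mul_mem_square _ _⟩ := by
  induction a using MvPolynomial.induction_on generalizing w with
  | C c =>
    rw [squareRep_C, squareRep_C]
    exact smul_mul' _ _ _
  | add p q hp hq =>
    rw [map_add, LinearMap.add_apply, LinearMap.add_apply, Submodule.coe_add, Submodule.coe_add,
      ← hp, ← hq, add_mul]
  | mul_X p x hp =>
    rw [map_mul, Module.End.mul_apply, Module.End.mul_apply, hp]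
    congr 2
    refine Subtype.ext ?_
    rw [squareRep_X]
    simp only [squareRep_X]
    exact (square_mul_lie w.2 _ _).symm

/-- The square as a module over the polynomial ring. -/
noncomputable abbrev squareModule : Module (MvPolynomial X k) (square k X) :=
  Module.compHom _ (squareRep (k := k) (X := X)).toRingHom

theorem isNoetherian_squareModule [Finite X] :
    letI := squareModule (k := k) (X := X)
    IsNoetherian (MvPolynomial X k) (square k X) := by
  let := squareModule (k := k) (X := X)
  have smul_def (a : MvPolynomial X k) (w : square k X) : a • w = squareRep a w := rfl
  -- Generators: a product (`true`) or bracket (`false`) of two letters, optionally multiplied by a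
  -- third letter. Multiplying by one more letter gives zero by `square_mul_mul`, and further
  -- brackets come from the polynomial action.
  let g : X × X × Option X × Bool → square k X := fun
    | (i, j, none, true) => ⟨letter k i * letter k j, mul_mem_square _ _⟩
    | (i, j, none, false) => ⟨⁅letter k i, letter k j⁆, lie_mem_square _ _⟩
    | (i, j, some l, true) => ⟨letter k i * letter k j * letter k l, mul_mem_square _ _⟩
    | (i, j, some l, false) => ⟨⁅letter k i, letter k j⁆ * letter k l, mul_mem_square _ _⟩
  let T := Submodule.span (MvPolynomial X k) (Set.range g)
  have hgT (p) : g p ∈ T := Submodule.subset_span ⟨p, rfl⟩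
  have hlie (w : square k X) (hw : w ∈ T) (x : X) :
      (⟨⁅(w : FreeMP k X), letter k x⁆, lie_mem_square _ _⟩ : square k X) ∈ T := by
    have h := T.smul_mem (MvPolynomial.X x) hw
    rwa [smul_def, show squareRep (MvPolynomial.X x) w = ⟨_, lie_mem_square _ _⟩ from
      Subtype.ext (squareRep_X x w)] at h
  have hmul (w : square k X) (hw : w ∈ T) (x : X) :
      (⟨(w : FreeMP k X) * letter k x, mul_mem_square _ _⟩ : square k X) ∈ T := by
    induction hw using Submodule.span_induction with
    | mem w hw =>
      obtain ⟨⟨i, j, _ | l, _ | _⟩, rfl⟩ := hw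
      · exact hgT (i, j, some x, false)
      · exact hgT (i, j, some x, true)
      · convert T.zero_mem
        exact square_mul_mul (lie_mem_square _ _) _ _
      · convert T.zero_mem
        exact square_mul_mul (mul_mem_square _ _) _ _
    | zero => convert T.zero_mem; exact zero_mul _
    | add a b _ _ ha hb => convert T.add_mem ha hb; exact add_mul _ _ _
    | smul a w _ hw =>
      convert T.smul_mem a hw
      exact squareRep_mul_letter a w _
  have hmono (n : ℕ) (W : FreeMP k X) (hW : IsMonomial k X n W) :
      (∃ x, W = letter k x) ∨ ∃ h : W ∈ square k X, (⟨W, h⟩ : square k X) ∈ T := by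
    induction hW with
    | letter x => exact Or.inl ⟨x, rfl⟩
    | @mul m n V W _ _ hV hW =>
      refine Or.inr ⟨mul_mem_square _ _, ?_⟩
      rcases hV with ⟨x, rfl⟩ | ⟨hV, hVT⟩ <;> rcases hW with ⟨y, rfl⟩ | ⟨hW, hWT⟩
      · exact hgT (x, y, none, true)
      · convert hmul _ hWT x using 2
        exact mul_comm _ _
      · exact hmul _ hVT y
      · convert T.zero_mem
        exact (square_square hV hW).1
    | @lie m n V W _ _ hV hW =>
      refine Or.inr ⟨lie_mem_square _ _, ?_⟩
      rcases hV with ⟨x, rfl⟩ | ⟨hV, hVT⟩ <;> rcases hW with ⟨y, rfl⟩ | ⟨hW, hWT⟩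
      · exact hgT (x, y, none, false)
      · convert T.neg_mem (hlie _ hWT x) using 1
        exact Subtype.ext (lie_skew _ _).symm
      · exact hlie _ hVT y
      · convert T.zero_mem
        exact (square_square hV hW).2
  have htop : T = ⊤ := by
    rw [eq_top_iff]
    rintro ⟨w, hw⟩ -
    have h : w ∈ nonlinearSpan k X := by rwa [nonlinearSpan_eq_square]
    induction h using Submodule.span_induction with
    | mem W h =>
      obtain ⟨n, hn, hW⟩ := h
      rcases hmono n W hW with ⟨x, rfl⟩ | ⟨_, hT⟩
      · have := coeff_eq_zero_of_mem_square hw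
        rw [coeff_letter] at this
        simp at this
      · exact hT
    | zero => exact T.zero_mem
    | add a b ha hb hT hT' =>
      have ha' : a ∈ square k X := by rwa [← nonlinearSpan_eq_square]
      have hb' : b ∈ square k X := by rwa [← nonlinearSpan_eq_square]
      exact T.add_mem (hT ha') (hT' hb')
    | smul c a ha hT =>
      have ha' : a ∈ square k X := by rwa [← nonlinearSpan_eq_square]
      have h := T.smul_mem (MvPolynomial.C c) (hT ha')
      rwa [smul_def, squareRep_C] at h
  have : Module.Finite (MvPolynomial X k) (square k X) :=
    ⟨Submodule.fg_def.mpr ⟨_, Set.finite_range g, htop⟩⟩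
  exact isNoetherian_of_isNoetherianRing_of_finite _ _

/-- Ascending chains of subspaces of the square closed under brackets with letters stabilize. -/
theorem exists_forall_eq_of_monotone [Finite X] (K : ℕ → Submodule k (FreeMP k X))
    (hmono : Monotone K) (hlie : ∀ m, ∀ w ∈ K m, ∀ x : X, ⁅w, letter k x⁆ ∈ K m) :
    ∃ n, ∀ w ∈ square k X, w ∈ K (n + 1) → w ∈ K n := by
  let := squareModule (k := k) (X := X)
  have hN : IsNoetherian (MvPolynomial X k) (square k X) := isNoetherian_squareModule
  -- Only the traces on the square are k[X]-submodules, so stabilization is obtained for elements of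
  -- the square alone.
  let K' : ℕ → Submodule (MvPolynomial X k) (square k X) := fun m =>
    { carrier := {w | (w : FreeMP k X) ∈ K m}
      add_mem' := (K m).add_mem
      zero_mem' := (K m).zero_mem
      smul_mem' := fun a w hw => squareRep_mem (hlie m) a w hw }
  obtain ⟨n, hn⟩ := monotone_stabilizes_iff_noetherian.mpr hN
    ⟨K', fun m m' h w hw => hmono h hw⟩
  refine ⟨n, fun w hw h => ?_⟩
  have h1 : (⟨w, hw⟩ : square k X) ∈ K' (n + 1) := h
  have h2 : K' n = K' (n + 1) := hn (n + 1) n.le_succ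
  rw [← h2] at h1
  exact h1

/-! ## Surjective endomorphisms are automorphisms -/

theorem inducedLinear_surjective {φ : PoissonHom k (FreeMP k X) (FreeMP k X)}
    (h : Function.Surjective φ) : Function.Surjective (inducedLinear φ) := by
  intro y
  obtain ⟨f, hf⟩ := h y
  refine ⟨linearPart f, ?_⟩
  rw [inducedLinear_linearPart, hf]
  exact Submodule.projectionOnto_apply_left _ y

instance [Finite X] : Module.Finite k (linearSpan k X) :=
  Module.Finite.of_basis (letterBasis k X)

/-- The free metabelian Poisson algebra on a finite set is Hopfian. -/
theorem bijective_of_surjective [Finite X] {φ : PoissonHom k (FreeMP k X) (FreeMP k X)}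
    (hφ : Function.Surjective φ) : Function.Bijective φ := by
  have hinj : Function.Injective (inducedLinear φ) :=
    LinearMap.injective_iff_surjective.mpr (inducedLinear_surjective hφ)
  -- Injectivity of φ̃ confines the kernels of all powers of φ to the square, where the chain
  -- condition applies.
  have hsq (f : FreeMP k X) (hf : φ f ∈ square k X) : f ∈ square k X := by
    rw [← linearPart_eq_zero_iff] at hf ⊢
    rw [← inducedLinear_linearPart] at hf
    exact hinj (hf.trans (map_zero _).symm)
  have hsq' (m : ℕ) (f : FreeMP k X) (hf : (φ)^[m] f ∈ square k X) : f ∈ square k X := by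
    induction m with
    | zero => exact hf
    | succ m ih => rw [Function.iterate_succ_apply'] at hf; exact ih (hsq _ hf)
  have hpow (m : ℕ) (f : FreeMP k X) : (φ.toLinearMap ^ m) f = (φ)^[m] f :=
    Module.End.pow_apply _ _ _
  have hlie (m : ℕ) (w : FreeMP k X) (hw : (φ)^[m] w = 0) (y : FreeMP k X) :
      (φ)^[m] ⁅w, y⁆ = 0 := by
    have (m : ℕ) : (φ)^[m] ⁅w, y⁆ = ⁅(φ)^[m] w, (φ)^[m] y⁆ := by
      induction m with
      | zero => rfl
      | succ m ih => rw [Function.iterate_succ_apply', ih, φ.map_lie, Function.iterate_succ_apply',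
          Function.iterate_succ_apply']
    rw [this, hw, zero_lie]
  obtain ⟨n, hn⟩ := exists_forall_eq_of_monotone
    (fun m => LinearMap.ker (φ.toLinearMap ^ m))
    (monotone_nat_of_le_succ fun m w hw => by
      rw [LinearMap.mem_ker, hpow] at hw ⊢
      rw [Function.iterate_succ_apply', hw]
      exact φ.apply_zero)
    (fun m w hw x => by
      rw [LinearMap.mem_ker, hpow] at hw ⊢
      exact hlie m w hw _)
  refine ⟨?_, hφ⟩
  refine (injective_iff_map_eq_zero φ.toLinearMap).mpr fun x hx => ?_
  -- Fitting's argument: a kernel element is φⁿ(y) with y in the kernel of φⁿ⁺¹, which adds nothing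
  -- to the kernel of φⁿ.
  obtain ⟨y, rfl⟩ := hφ.iterate n x
  have h1 : (φ)^[n + 1] y = 0 := by rw [Function.iterate_succ_apply']; exact hx
  have h2 := hn y (hsq' (n + 1) y (by rw [h1]; exact Submodule.zero_mem _))
    (by rw [LinearMap.mem_ker, hpow]; exact h1)
  rwa [LinearMap.mem_ker, hpow] at h2

/-! ## The range of an endomorphism -/

section Range

variable {φ : PoissonHom k (FreeMP k X) (FreeMP k X)}

theorem mul_mem_range {x y : FreeMP k X} (hx : x ∈ LinearMap.range φ.toLinearMap)
    (hy : y ∈ LinearMap.range φ.toLinearMap) : x * y ∈ LinearMap.range φ.toLinearMap := by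
  obtain ⟨a, rfl⟩ := hx
  obtain ⟨b, rfl⟩ := hy
  exact ⟨a * b, φ.map_mul a b⟩

theorem lie_mem_range {x y : FreeMP k X} (hx : x ∈ LinearMap.range φ.toLinearMap)
    (hy : y ∈ LinearMap.range φ.toLinearMap) : ⁅x, y⁆ ∈ LinearMap.range φ.toLinearMap := by
  obtain ⟨a, rfl⟩ := hx
  obtain ⟨b, rfl⟩ := hy
  exact ⟨⁅a, b⁆, φ.map_lie a b⟩

theorem surjective_of_letter_mem (h : ∀ x, letter k x ∈ LinearMap.range φ.toLinearMap) :
    Function.Surjective φ := by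
  intro f
  suffices h : f ∈ LinearMap.range φ.toLinearMap from h
  induction f using induction_on with
  | h_letter x => exact h x
  | h_zero => exact Submodule.zero_mem _
  | h_add a b ha hb => exact Submodule.add_mem _ ha hb
  | h_smul t a ha => exact Submodule.smul_mem _ t ha
  | h_mul a b ha hb => exact mul_mem_range ha hb
  | h_lie a b ha hb => exact lie_mem_range ha hb

/-- If the range of `φ` and the square span the algebra, then the part of the range inside the
square is a Poisson ideal. -/
theorem isPoissonIdeal_range_inf
    (h : ∀ f : FreeMP k X, ∃ b ∈ LinearMap.range φ.toLinearMap, f - b ∈ square k X) :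
    IsPoissonIdeal (LinearMap.range φ.toLinearMap ⊓ square k X) := by
  rintro x ⟨hx, hx'⟩ p
  obtain ⟨b, hb, hs⟩ := h p
  have hp : p = b + (p - b) := (add_sub_cancel b p).symm
  -- Modulo the square, p may be replaced by an element b of the range; the difference acts on x by
  -- zero.
  have h0 := square_square hx' hs
  refine ⟨⟨?_, mul_mem_square _ _⟩, ⟨?_, lie_mem_square _ _⟩⟩
  · rw [hp, mul_add, h0.1, add_zero]
    exact mul_mem_range hx hb
  · rw [hp, lie_add, h0.2, add_zero]
    exact lie_mem_range hx hb

end Range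

/-! ## The criterion in terms of the nonlinear parts -/

/-- By surjectivity the square is the image of the square, hence spanned by images of monomials of
length at least two. Such an image either combines the images of two letters or has a factor already
in the ideal. -/
theorem square_le_of_isPoissonIdeal {φ : PoissonHom k (FreeMP k X) (FreeMP k X)}
    (hφ : Function.Surjective φ) {I : Submodule k (FreeMP k X)} (hI : IsPoissonIdeal I)
    (hS : ∀ i j : X, ⁅φ (letter k i), φ (letter k j)⁆ ∈ I ∧
      φ (letter k i) * φ (letter k j) ∈ I) : square k X ≤ I := by
  have hmono (n : ℕ) (W : FreeMP k X) (hW : IsMonomial k X n W) :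
      (∃ x, W = letter k x) ∨ φ W ∈ I := by
    induction hW with
    | letter x => exact Or.inl ⟨x, rfl⟩
    | @mul m n V W _ _ hV hW =>
      right
      rw [φ.map_mul]
      rcases hV with ⟨x, rfl⟩ | hV
      · rcases hW with ⟨y, rfl⟩ | hW
        · exact (hS x y).2
        · rw [mul_comm]; exact (hI _ hW _).1
      · exact (hI _ hV _).1
    | @lie m n V W _ _ hV hW =>
      right
      rw [φ.map_lie]
      rcases hV with ⟨x, rfl⟩ | hV
      · rcases hW with ⟨y, rfl⟩ | hW
        · exact (hS x y).1
        · rw [← lie_skew]; exact I.neg_mem (hI _ hW _).2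
      · exact (hI _ hV _).2
  have hsq : nonlinearSpan k X ≤ I.comap φ.toLinearMap := by
    refine Submodule.span_le.mpr ?_
    rintro W ⟨n, hn, hW⟩
    rcases hmono n W hW with ⟨x, rfl⟩ | h
    · have := hW.coeff_eq_zero hn
      rw [coeff_letter] at this
      simp at this
    · exact h
  rw [nonlinearSpan_eq_square] at hsq
  refine Submodule.span_le.mpr ?_
  rintro W ⟨a, b, h⟩
  obtain ⟨a, rfl⟩ := hφ a
  obtain ⟨b, rfl⟩ := hφ b
  rcases h with rfl | rfl
  · rw [← φ.map_mul]; exact hsq (mul_mem_square a b)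
  · rw [← φ.map_lie]; exact hsq (lie_mem_square a b)

theorem poissonIdeal_le {S : Set (FreeMP k X)} {I : Submodule k (FreeMP k X)}
    (hI : IsPoissonIdeal I) (h : S ⊆ I) : poissonIdeal k S ≤ I := sInf_le ⟨hI, h⟩

theorem subset_poissonIdeal (S : Set (FreeMP k X)) : S ⊆ poissonIdeal k S := fun _ hx =>
  Submodule.mem_sInf.mpr fun _ hI => hI.2 hx

theorem exists_range_of_inducedLinear_surjective
    {φ : PoissonHom k (FreeMP k X) (FreeMP k X)} (h : Function.Surjective (inducedLinear φ))
    (f : FreeMP k X) : ∃ b ∈ LinearMap.range φ.toLinearMap, f - b ∈ square k X := by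
  obtain ⟨y, hy⟩ := h (linearPart f)
  refine ⟨φ y, ⟨y, rfl⟩, ?_⟩
  rw [← linearPart_eq_zero_iff, map_sub, ← hy, ← inducedLinear_linearPart,
    show linearPart (y : FreeMP k X) = y from Submodule.projectionOnto_apply_left _ y, sub_self]

theorem bijective_iff_nonlinearPart_mem [Finite X]
    (φ : PoissonHom k (FreeMP k X) (FreeMP k X)) :
    Function.Bijective φ ↔
      Function.Bijective (inducedLinear φ) ∧
      ∀ m : X, (nonlinearPart (φ (letter k m)) : FreeMP k X) ∈
        poissonIdeal k
          {s : FreeMP k X | ∃ i j : X,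
            s = ⁅φ (letter k i), φ (letter k j)⁆ ∨ s = φ (letter k i) * φ (letter k j)} := by
  constructor
  · intro h
    have hs := inducedLinear_surjective h.surjective
    refine ⟨⟨LinearMap.injective_iff_surjective.mpr hs, hs⟩, fun m => ?_⟩
    refine square_le_of_isPoissonIdeal h.surjective (isPoissonIdeal_poissonIdeal k _)
      (fun i j => ⟨?_, ?_⟩) ?_
    · exact subset_poissonIdeal _ ⟨i, j, Or.inl rfl⟩
    · exact subset_poissonIdeal _ ⟨i, j, Or.inr rfl⟩
    rw [← nonlinearSpan_eq_square]
    exact (nonlinearPart (φ (letter k m))).2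
  · rintro ⟨hb, hm⟩
    have hr := exists_range_of_inducedLinear_surjective hb.surjective
    have hφr (i : X) : φ (letter k i) ∈ LinearMap.range φ.toLinearMap := ⟨_, rfl⟩
    have hle := poissonIdeal_le (S := {s : FreeMP k X | ∃ i j : X,
        s = ⁅φ (letter k i), φ (letter k j)⁆ ∨ s = φ (letter k i) * φ (letter k j)})
      (isPoissonIdeal_range_inf hr) (by
        rintro _ ⟨i, j, rfl | rfl⟩
        · exact Submodule.mem_inf.mpr ⟨lie_mem_range (hφr i) (hφr j), lie_mem_square _ _⟩
        · exact Submodule.mem_inf.mpr ⟨mul_mem_range (hφr i) (hφr j), mul_mem_square _ _⟩)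
    -- The linear part of the image of a letter is that image minus its nonlinear part, and both lie
    -- in the range.
    have hlin (y : linearSpan k X) : (inducedLinear φ y : FreeMP k X) ∈
        LinearMap.range φ.toLinearMap := by
      rw [← (letterBasis k X).linearCombination_repr y, Finsupp.linearCombination_apply,
        Finsupp.sum, map_sum, Submodule.coe_sum]
      refine Submodule.sum_mem _ fun x _ => ?_
      rw [map_smul]
      refine Submodule.smul_mem _ _ ?_
      rw [inducedLinear, Module.Basis.constr_basis, eq_sub_of_add_eq
        (linearPart_add_nonlinearPart (φ (letter k x)))]
      exact Submodule.sub_mem _ ⟨_, rfl⟩ (Submodule.mem_inf.mp (hle (hm x))).1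
    refine bijective_of_surjective (surjective_of_letter_mem fun x => ?_)
    obtain ⟨y, hy⟩ := hb.surjective (letterBasis k X x)
    rw [← letterBasis_apply, ← hy]
    exact hlin y

end FreeMP

/-! ## The Magnus embedding and Fox derivatives -/

/-- The Magnus algebra of an `A`-module `M`: the space `A × M` with zero product and the bracket
`⁅(a, u), (b, v)⁆ = (0, b u - a v)`. -/
def MagnusAlgebra (A : Type v) (M : Type w) : Type (max v w) := A × M

namespace MagnusAlgebra

variable {k : Type u} {A : Type v} {M : Type w} [Field k] [CommRing A] [Algebra k A]
  [AddCommGroup M] [Module k M]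

@[ext] theorem ext {A : Type v} {M : Type w} {x y : MagnusAlgebra A M} (h1 : x.1 = y.1)
    (h2 : x.2 = y.2) : x = y := Prod.ext h1 h2

instance instAddCommGroup : AddCommGroup (MagnusAlgebra A M) := inferInstanceAs (AddCommGroup (A × M))

instance instModule : Module k (MagnusAlgebra A M) := inferInstanceAs (Module k (A × M))

theorem fst_add (x y : MagnusAlgebra A M) : (x + y).1 = x.1 + y.1 := rfl
theorem snd_add (x y : MagnusAlgebra A M) : (x + y).2 = x.2 + y.2 := rfl
theorem fst_zero : (0 : MagnusAlgebra A M).1 = 0 := rfl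
theorem snd_zero : (0 : MagnusAlgebra A M).2 = 0 := rfl
theorem fst_smul (c : k) (x : MagnusAlgebra A M) : (c • x).1 = c • x.1 := rfl
theorem snd_smul (c : k) (x : MagnusAlgebra A M) : (c • x).2 = c • x.2 := rfl

instance : Mul (MagnusAlgebra A M) := ⟨fun _ _ => 0⟩

theorem mul_def (x y : MagnusAlgebra A M) : x * y = 0 := rfl

variable [Module A M] [IsScalarTower k A M]

instance : Bracket (MagnusAlgebra A M) (MagnusAlgebra A M) :=
  ⟨fun x y => (0, y.1 • x.2 - x.1 • y.2)⟩

theorem fst_lie (x y : MagnusAlgebra A M) : ⁅x, y⁆.1 = 0 := rfl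
theorem snd_lie (x y : MagnusAlgebra A M) : ⁅x, y⁆.2 = y.1 • x.2 - x.1 • y.2 := rfl

instance : PoissonRing (MagnusAlgebra A M) where
  __ := instAddCommGroup (A := A) (M := M)
  left_distrib _ _ _ := (add_zero 0).symm
  right_distrib _ _ _ := (add_zero 0).symm
  zero_mul _ := rfl
  mul_zero _ := rfl
  mul_assoc _ _ _ := rfl
  mul_comm _ _ := rfl
  add_lie x y z := by
    ext1
    · simp [fst_lie, fst_add]
    · simp only [snd_lie, fst_add, snd_add]; module
  lie_add x y z := by
    ext1
    · simp [fst_lie, fst_add]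
    · simp only [snd_lie, fst_add, snd_add]; module
  lie_self x := by
    ext1
    · rfl
    · simp [snd_lie, snd_zero]
  leibniz_lie x y z := by
    ext1
    · simp [fst_lie, fst_add]
    · simp only [snd_lie, fst_lie, snd_add]; module
  leibniz x y z := by
    ext1
    · simp [fst_lie, mul_def, fst_zero]
    · simp [snd_lie, mul_def, fst_zero, snd_zero]

instance : PoissonAlgebra k (MagnusAlgebra A M) where
  __ := instModule (k := k) (A := A) (M := M)
  lie_smul c x y := by
    ext1
    · simp [fst_lie, fst_smul]
    · simp only [snd_lie, fst_smul, snd_smul, smul_sub, smul_assoc]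
      rw [smul_algebra_smul_comm c x.1 y.2]
  smul_mul c x y := (smul_zero c).symm

variable (k A M) in
theorem isMetabelianPoisson : IsMetabelianPoisson k (MagnusAlgebra A M) := by
  -- The abelian ideal is {0} × M.
  refine ⟨LinearMap.ker (LinearMap.fst k A M), fun x hx p => ⟨?_, ?_⟩, fun x hx y hy => ⟨rfl, ?_⟩,
    fun x y => ⟨?_, ?_⟩⟩
  · exact Submodule.zero_mem _
  · exact rfl
  · have hx : x.1 = 0 := hx
    have hy : y.1 = 0 := hy
    ext1
    · rfl
    · rw [snd_lie, hx, hy, zero_smul, zero_smul, sub_zero]; rfl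
  · exact Submodule.zero_mem _
  · exact rfl

end MagnusAlgebra

namespace PoissonHom

variable {k : Type*} {P Q R : Type*} [Field k] [PoissonRing P] [PoissonAlgebra k P]
  [PoissonRing Q] [PoissonAlgebra k Q] [PoissonRing R] [PoissonAlgebra k R]

/-- Composition of homomorphisms of Poisson algebras. -/
def comp (ψ : PoissonHom k Q R) (φ : PoissonHom k P Q) : PoissonHom k P R where
  __ := ψ.toLinearMap ∘ₗ φ.toLinearMap
  map_mul x y := (congrArg ψ (φ.map_mul x y)).trans (ψ.map_mul _ _)
  map_lie x y := (congrArg ψ (φ.map_lie x y)).trans (ψ.map_lie _ _)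

end PoissonHom

namespace FreeMP

/-! ### Products, and brackets modulo products. -/

section Products

variable {k : Type u} {X : Type v} [Field k]

/-- The span of the products. -/
def productSpan (k : Type u) (X : Type v) [Field k] : Submodule k (FreeMP k X) :=
  Submodule.span k {w | ∃ a b : FreeMP k X, w = a * b}

theorem mul_mem_productSpan (a b : FreeMP k X) : a * b ∈ productSpan k X :=
  Submodule.subset_span ⟨a, b, rfl⟩

/-- By the Leibniz identity the bracket of a product is a sum of products; this makes it possible to
compute with brackets modulo products. -/
theorem lie_mem_productSpan {w : FreeMP k X} (hw : w ∈ productSpan k X) (y : FreeMP k X) :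
    ⁅w, y⁆ ∈ productSpan k X := by
  induction hw using Submodule.span_induction with
  | mem w hw =>
    obtain ⟨a, b, rfl⟩ := hw
    rw [← lie_skew, PoissonRing.leibniz]
    exact Submodule.neg_mem _ (Submodule.add_mem _ (mul_mem_productSpan _ _)
      (mul_mem_productSpan _ _))
  | zero => rw [zero_lie]; exact Submodule.zero_mem _
  | add a b _ _ ha hb => rw [add_lie]; exact Submodule.add_mem _ ha hb
  | smul t a _ ha => rw [smul_lie]; exact Submodule.smul_mem _ t ha

variable [Fintype X]

/-- The bracket of the vector `u`, understood as a combination of letters, with `v`. -/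
noncomputable def lieVec (v : FreeMP k X) (u : X → MvPolynomial X k) : square k X :=
  ∑ x, squareRep (u x) ⟨⁅letter k x, v⁆, lie_mem_square _ _⟩

theorem lieVec_add (v : FreeMP k X) (a b : X → MvPolynomial X k) :
    lieVec v (a + b) = lieVec v a + lieVec v b := by
  simp [lieVec, Finset.sum_add_distrib]

theorem lieVec_sub (v : FreeMP k X) (a b : X → MvPolynomial X k) :
    lieVec v (a - b) = lieVec v a - lieVec v b := by
  simp [lieVec]

theorem lieVec_smul (v : FreeMP k X) (p : MvPolynomial X k) (a : X → MvPolynomial X k) :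
    lieVec v (p • a) = squareRep p (lieVec v a) := by
  simp [lieVec, Module.End.mul_apply]

end Products

/-! ### The Magnus homomorphism and the identities of Fox calculus. -/

variable {k : Type u} {X : Type v} [Field k] [DecidableEq X]

variable (k X) in
/-- The Magnus homomorphism of the free metabelian Poisson algebra. -/
noncomputable def magnus : PoissonHom k (FreeMP k X)
    (MagnusAlgebra (MvPolynomial X k) (X → MvPolynomial X k)) :=
  lift (MagnusAlgebra.isMetabelianPoisson _ _ _) fun x => (MvPolynomial.X x, Pi.single x 1)

/-- The linear part as a linear form. -/
noncomputable def linForm : FreeMP k X →ₗ[k] MvPolynomial X k :=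
  LinearMap.fst k _ _ ∘ₗ (magnus k X).toLinearMap

/-- The vector of Fox derivatives. -/
noncomputable def fox : FreeMP k X →ₗ[k] (X → MvPolynomial X k) :=
  LinearMap.snd k _ _ ∘ₗ (magnus k X).toLinearMap

theorem magnus_apply (f : FreeMP k X) : magnus k X f = (linForm f, fox f) := rfl

theorem linForm_letter (x : X) : linForm (letter k x) = MvPolynomial.X x := rfl

theorem fox_letter (x : X) : fox (letter k x) = Pi.single x 1 := rfl

theorem linForm_mul (f g : FreeMP k X) : linForm (f * g) = 0 :=
  congrArg Prod.fst ((magnus k X).map_mul f g)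

theorem fox_mul (f g : FreeMP k X) : fox (f * g) = 0 :=
  congrArg Prod.snd ((magnus k X).map_mul f g)

theorem linForm_lie (f g : FreeMP k X) : linForm ⁅f, g⁆ = 0 :=
  congrArg Prod.fst ((magnus k X).map_lie f g)

theorem fox_lie (f g : FreeMP k X) : fox ⁅f, g⁆ = linForm g • fox f - linForm f • fox g :=
  congrArg Prod.snd ((magnus k X).map_lie f g)

theorem linForm_eq_zero {f : FreeMP k X} (hf : f ∈ square k X) : linForm f = 0 := by
  have : square k X ≤ LinearMap.ker (linForm (k := k) (X := X)) := by
    refine Submodule.span_le.mpr ?_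
    rintro W ⟨a, b, rfl | rfl⟩
    · exact linForm_mul a b
    · exact linForm_lie a b
  exact this hf

theorem constantCoeff_linForm (f : FreeMP k X) : MvPolynomial.constantCoeff (linForm f) = 0 := by
  induction f using induction_on with
  | h_letter x => rw [linForm_letter, MvPolynomial.constantCoeff_X]
  | h_zero => rw [map_zero, map_zero]
  | h_add a b ha hb => rw [map_add, map_add, ha, hb, add_zero]
  | h_smul t a ha => rw [map_smul, MvPolynomial.constantCoeff_smul, ha, smul_zero]
  | h_mul a b _ _ => rw [linForm_mul, map_zero]
  | h_lie a b _ _ => rw [linForm_lie, map_zero]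

/-- At the origin the Jacobian matrix becomes the matrix of φ̃, so an invertible Jacobian also
controls the linear parts. -/
theorem constantCoeff_fox (f : FreeMP k X) (x : X) :
    MvPolynomial.constantCoeff (fox f x) = coeff f x := by
  induction f using induction_on with
  | h_letter y =>
    rw [fox_letter, coeff_letter, Pi.single_apply, Finsupp.single_apply]
    by_cases h : x = y
    · simp [h]
    · simp [h, Ne.symm h]
  | h_zero => simp
  | h_add a b ha hb => simp [ha, hb]
  | h_smul t a ha => simp [ha]
  | h_mul a b _ _ => simp [fox_mul, coeff_mul]
  | h_lie a b _ _ => simp [fox_lie, coeff_lie, constantCoeff_linForm]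

/-- The fundamental formula of Fox calculus. On brackets the two contributions are the same product
of linear forms with opposite signs. For elements of the square it is a linear relation between the
Fox derivatives. -/
theorem linForm_eq_sum [Fintype X] (f : FreeMP k X) :
    linForm f = ∑ x, fox f x * MvPolynomial.X x := by
  induction f using induction_on with
  | h_letter y => simp [fox_letter, linForm_letter, Pi.single_apply]
  | h_zero => simp
  | h_add a b ha hb => simp [ha, hb, add_mul, Finset.sum_add_distrib]
  | h_smul t a ha => simp [ha, Finset.smul_sum]
  | h_mul a b _ _ => simp [fox_mul, linForm_mul]
  | h_lie a b ha hb =>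
    simp only [fox_lie, linForm_lie, Pi.sub_apply, Pi.smul_apply, smul_eq_mul, sub_mul,
      Finset.sum_sub_distrib, mul_assoc, ← Finset.mul_sum, ← ha, ← hb]
    ring

/-- The nonlinear part of `f` brackets trivially with the square, so only its linear form acts. -/
theorem squareRep_linForm (f : FreeMP k X) (w : square k X) :
    (squareRep (linForm f) w : FreeMP k X) = ⁅(w : FreeMP k X), f⁆ := by
  induction f using induction_on with
  | h_letter x => exact squareRep_X x w
  | h_zero => simp
  | h_add a b ha hb => simp [ha, hb]
  | h_smul t a ha => simp [ha]
  | h_mul a b _ _ =>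
    rw [linForm_mul, map_zero, (square_square w.2 (mul_mem_square a b)).2]; rfl
  | h_lie a b _ _ =>
    rw [linForm_lie, map_zero, (square_square w.2 (lie_mem_square a b)).2]; rfl

/-- On the square the linear form vanishes, and a bracket with a letter just multiplies the Fox
vector by the variable. -/
theorem fox_squareRep (a : MvPolynomial X k) (w : square k X) :
    fox (squareRep a w : FreeMP k X) = a • fox (w : FreeMP k X) := by
  induction a using MvPolynomial.induction_on generalizing w with
  | C c => rw [squareRep_C, Submodule.coe_smul, map_smul]; ext; simp [MvPolynomial.smul_eq_C_mul]
  | add p q hp hq =>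
    rw [map_add, LinearMap.add_apply, Submodule.coe_add, map_add, hp, hq, add_smul]
  | mul_X p x hp =>
    rw [map_mul, Module.End.mul_apply, hp, squareRep_X, fox_lie, linForm_eq_zero w.2, zero_smul,
      sub_zero, linForm_letter, mul_smul]

/-! ### The chain rule -/

section ChainRule

variable [Fintype X] (φ : PoissonHom k (FreeMP k X) (FreeMP k X))

/-- The substitution of linear forms induced by an endomorphism. -/
noncomputable def linSubst : MvPolynomial X k →ₐ[k] MvPolynomial X k :=
  MvPolynomial.aeval fun x => linForm (φ (letter k x))

/-- The semilinear endomorphism of the space of vectors induced by an endomorphism, with the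
Fox derivatives of the images of the letters as images of the unit vectors. -/
noncomputable def foxSubst (u : X → MvPolynomial X k) : X → MvPolynomial X k :=
  ∑ x, linSubst φ (u x) • fox (φ (letter k x))

theorem foxSubst_add (u v : X → MvPolynomial X k) :
    foxSubst φ (u + v) = foxSubst φ u + foxSubst φ v := by
  simp [foxSubst, add_smul, Finset.sum_add_distrib]

theorem foxSubst_sub (u v : X → MvPolynomial X k) :
    foxSubst φ (u - v) = foxSubst φ u - foxSubst φ v := by
  simp [foxSubst, sub_smul]

theorem foxSubst_smul (a : MvPolynomial X k) (u : X → MvPolynomial X k) :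
    foxSubst φ (a • u) = linSubst φ a • foxSubst φ u := by
  simp [foxSubst, mul_smul, Finset.smul_sum]

theorem foxSubst_zero : foxSubst φ 0 = 0 := by simp [foxSubst]

/-- The endomorphism of the Magnus algebra induced by an endomorphism of the free metabelian
Poisson algebra. -/
noncomputable def magnusMap :
    PoissonHom k (MagnusAlgebra (MvPolynomial X k) (X → MvPolynomial X k))
      (MagnusAlgebra (MvPolynomial X k) (X → MvPolynomial X k)) where
  toFun p := (linSubst φ p.1, foxSubst φ p.2)
  map_add' p q := MagnusAlgebra.ext (map_add _ _ _) (foxSubst_add φ _ _)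
  map_smul' c p := by
    refine MagnusAlgebra.ext (map_smul _ _ _) ?_
    change foxSubst φ (c • p.2) = c • foxSubst φ p.2
    rw [← algebraMap_smul (MvPolynomial X k) c p.2, foxSubst_smul, AlgHom.commutes,
      algebraMap_smul]
  map_mul p q := MagnusAlgebra.ext (map_zero _) (foxSubst_zero φ)
  map_lie p q := by
    refine MagnusAlgebra.ext (map_zero _) ?_
    change foxSubst φ (q.1 • p.2 - p.1 • q.2) =
      linSubst φ q.1 • foxSubst φ p.2 - linSubst φ p.1 • foxSubst φ q.2
    rw [foxSubst_sub, foxSubst_smul, foxSubst_smul]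

/-- Both sides are homomorphisms out of the free algebra, so agreement on letters suffices. The
second component is the chain rule. -/
theorem magnus_apply_apply (f : FreeMP k X) :
    magnus k X (φ f) = magnusMap φ (magnus k X f) := by
  refine hom_ext (φ := (magnus k X).comp φ) (ψ := (magnusMap φ).comp (magnus k X))
    (fun x => ?_) f
  change magnus k X (φ (letter k x)) = magnusMap φ (magnus k X (letter k x))
  rw [magnus_apply, magnus_apply, linForm_letter, fox_letter]
  change _ = (linSubst φ (MvPolynomial.X x),
    ∑ y, linSubst φ ((Pi.single x 1 : X → MvPolynomial X k) y) • fox (φ (letter k y)))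
  rw [linSubst, MvPolynomial.aeval_X, Finset.sum_eq_single x]
  · simp
  · intro y _ h; simp [h]
  · simp

theorem fox_apply (f : FreeMP k X) :
    fox (φ f) = ∑ x, linSubst φ (fox f x) • fox (φ (letter k x)) :=
  congrArg Prod.snd (magnus_apply_apply φ f)

/-- The Jacobian matrix of an endomorphism. -/
noncomputable def jacobian : Matrix X X (MvPolynomial X k) :=
  Matrix.of fun i => fox (φ (letter k i))

theorem isUnit_det_jacobian_of_surjective (h : Function.Surjective φ) :
    IsUnit (jacobian φ).det := by
  -- The chain rule applied to preimages `g x` of the letters expresses the unit vectors through the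
  -- rows of the Jacobian, giving a left inverse.
  choose g hg using fun x => h (letter k x)
  refine Matrix.isUnit_det_of_left_inverse
    (B := Matrix.of fun i j => linSubst φ (fox (g i) j)) ?_
  ext1 i j
  have := congrFun (fox_apply φ (g i)) j
  rw [hg, fox_letter] at this
  rw [Matrix.mul_apply, Matrix.one_apply]
  simp only [Finset.sum_apply, Pi.smul_apply, smul_eq_mul, Pi.single_apply] at this
  simpa [jacobian, eq_comm] using this.symm

end ChainRule

/-! ### Invertible Jacobian matrices -/

section Jacobian

variable [Fintype X]

theorem lieVec_single (v : FreeMP k X) (x : X) :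
    (lieVec v (Pi.single x 1) : FreeMP k X) = ⁅letter k x, v⁆ := by
  rw [lieVec, Finset.sum_eq_single x]
  · simp
  · intro y _ h; simp [h]
  · simp

/-- Modulo products, the bracket with `v` is determined by the Fox derivatives. -/
theorem lie_sub_lieVec_mem (v f : FreeMP k X) :
    ⁅f, v⁆ - (lieVec v (fox f) : FreeMP k X) ∈ productSpan k X := by
  induction f using induction_on with
  | h_letter x => rw [fox_letter, lieVec_single, sub_self]; exact Submodule.zero_mem _
  | h_zero => simp [lieVec]
  | h_add a b ha hb =>
    rw [map_add, lieVec_add, add_lie, Submodule.coe_add, add_sub_add_comm]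
    exact Submodule.add_mem _ ha hb
  | h_smul t a ha =>
    rw [map_smul, ← algebraMap_smul (MvPolynomial X k) t (fox a), lieVec_smul,
      MvPolynomial.algebraMap_eq, squareRep_C, smul_lie, Submodule.coe_smul, ← smul_sub]
    exact Submodule.smul_mem _ t ha
  | h_mul a b _ _ =>
    rw [fox_mul, show lieVec v (0 : X → MvPolynomial X k) = 0 by simp [lieVec],
      Submodule.coe_zero, sub_zero]
    exact lie_mem_productSpan (mul_mem_productSpan a b) v
  | h_lie a b ha hb =>
    have h := Submodule.sub_mem _ (lie_mem_productSpan ha b) (lie_mem_productSpan hb a)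
    rw [fox_lie, lieVec_sub, lieVec_smul, lieVec_smul, Submodule.coe_sub, squareRep_linForm,
      squareRep_linForm]
    convert h using 1
    -- This form of the Jacobi identity matches the Fox rule for brackets, with `v` bracketed into
    -- each entry.
    have e : ⁅⁅a, b⁆, v⁆ = ⁅⁅a, v⁆, b⁆ - ⁅⁅b, v⁆, a⁆ := by
      rw [lie_lie a b v, ← lie_skew ⁅b, v⁆ a, ← lie_skew b ⁅a, v⁆]
      abel
    rw [e, sub_lie, sub_lie]
    abel

/-- A weak injectivity of the Magnus homomorphism modulo products, at the price of one extra bracket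
with `v`. -/
theorem lie_mem_productSpan_of_fox_eq_zero {f : FreeMP k X} (hf : fox f = 0) (v : FreeMP k X) :
    ⁅f, v⁆ ∈ productSpan k X := by
  have h := lie_sub_lieVec_mem v f
  rwa [hf, show lieVec v (0 : X → MvPolynomial X k) = 0 by simp [lieVec],
    Submodule.coe_zero, sub_zero] at h

/-- Let B be the range. The constant terms of the Jacobian give P = B + P². Fox derivatives then
give P² ⊆ (B ∩ P²) + products, first for double brackets of elements of P², then for single
brackets, then for P² itself. Finally products lie in B, since modulo B each is a sum of products
with a factor in P², and threefold products lie in B. -/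
theorem surjective_of_isUnit_det_jacobian {φ : PoissonHom k (FreeMP k X) (FreeMP k X)}
    (h : IsUnit (jacobian φ).det) : Function.Surjective φ := by
  have hspan (u : X → MvPolynomial X k) :
      ∃ a : X → MvPolynomial X k, u = ∑ x, a x • fox (φ (letter k x)) := by
    refine ⟨Matrix.vecMul u (jacobian φ)⁻¹, ?_⟩
    change _ = ∑ x, Matrix.vecMul u (jacobian φ)⁻¹ x • jacobian φ x
    rw [← Matrix.vecMul_eq_sum, Matrix.vecMul_vecMul,
      Matrix.nonsing_inv_mul _ h, Matrix.vecMul_one]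
  have hletter (x : X) : φ (letter k x) ∈ LinearMap.range φ.toLinearMap := ⟨_, rfl⟩
  have hdec (f : FreeMP k X) : ∃ b ∈ LinearMap.range φ.toLinearMap, f - b ∈ square k X := by
    obtain ⟨a, ha⟩ := hspan (fox f)
    refine ⟨∑ x, MvPolynomial.constantCoeff (a x) • φ (letter k x),
      Submodule.sum_mem _ fun x _ => Submodule.smul_mem _ _ (hletter x), ?_⟩
    rw [mem_square_iff]
    ext y
    simp only [map_sub, map_sum, map_smul, Finsupp.coe_sub, Pi.sub_apply, Finsupp.coe_finsetSum,
      Finset.sum_apply, Finsupp.coe_smul, Pi.smul_apply, ← constantCoeff_fox]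
    rw [ha]
    simp
  have hI := isPoissonIdeal_range_inf hdec
  set B := LinearMap.range φ.toLinearMap with hB
  have hlie (w : FreeMP k X) (hw : w ∈ square k X) (u v : FreeMP k X) :
      ⁅⁅w, u⁆, v⁆ ∈ B ⊓ square k X ⊔ productSpan k X := by
    obtain ⟨b, hb, hu⟩ := hdec u
    have e : ⁅w, u⁆ = ⁅w, b⁆ := by
      have := (square_square hw hu).2
      rwa [lie_sub, sub_eq_zero] at this
    obtain ⟨a, ha⟩ := hspan (fox w)
    -- The linear form of `w` is zero, so the fundamental formula yields a relation between the
    -- linear forms of the images of the letters.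
    have h0 : ∑ x, a x * linForm (φ (letter k x)) = 0 := by
      have h1 := linForm_eq_sum w
      rw [linForm_eq_zero hw, ha] at h1
      simp only [Finset.sum_apply, Pi.smul_apply, smul_eq_mul, Finset.sum_mul, mul_assoc] at h1
      rw [Finset.sum_comm] at h1
      simp only [← Finset.mul_sum, ← linForm_eq_sum] at h1
      exact h1.symm
    -- Replacing the Fox vector of `w` by its expansion in the rows suggests this element of the
    -- range. Its Fox vector equals that of `⁅w, b⁆`, because the terms with `fox b` cancel by `h0`.
    let s : square k X :=
      ∑ x, squareRep (a x) ⟨⁅φ (letter k x), b⁆, lie_mem_square _ _⟩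
    have hs : (s : FreeMP k X) ∈ B ⊓ square k X := by
      rw [Submodule.coe_sum]
      refine Submodule.sum_mem _ fun x _ => ?_
      refine squareRep_mem (fun w hw x => (hI w hw _).2) _ _ ?_
      exact Submodule.mem_inf.mpr ⟨lie_mem_range (hletter x) hb, lie_mem_square _ _⟩
    have hfox : fox (⁅w, b⁆ - (s : FreeMP k X)) = 0 := by
      rw [map_sub, fox_lie, linForm_eq_zero hw, zero_smul, sub_zero, ha, Submodule.coe_sum,
        map_sum]
      simp only [fox_squareRep, fox_lie, smul_sub, Finset.sum_sub_distrib, Finset.smul_sum]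
      simp only [← mul_smul, ← Finset.sum_smul, h0, zero_smul, sub_zero, mul_comm, sub_self]
    have h1 := lie_mem_productSpan_of_fox_eq_zero hfox v
    rw [sub_lie] at h1
    rw [e, ← sub_add_cancel ⁅⁅w, b⁆, v⁆ ⁅(s : FreeMP k X), v⁆]
    exact Submodule.add_mem _ (Submodule.mem_sup_right h1)
      (Submodule.mem_sup_left (hI _ hs v).2)
  have hmulB (x y : FreeMP k X) : ∃ b ∈ B, ∃ w ∈ square k X, ∃ z, ∃ w' ∈ square k X, ∃ z',
      x * y = b + w * z + w' * z' := by
    obtain ⟨b, hb, hx⟩ := hdec x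
    obtain ⟨c, hc, hy⟩ := hdec y
    refine ⟨b * c, mul_mem_range hb hc, _, hx, y, _, hy, b, ?_⟩
    rw [sub_mul, sub_mul, mul_comm y b, mul_comm c b]
    abel
  -- In the third factor, and in the correction terms of `x * y`, everything from the square is
  -- annihilated, leaving a product of two elements of B.
  have hmulmul (x y z : FreeMP k X) : x * y * z ∈ B := by
    obtain ⟨b, hb, w, hw, u, w', hw', u', e⟩ := hmulB x y
    obtain ⟨c, hc, hz⟩ := hdec z
    have e' : x * y * z = x * y * c := by
      have := (square_square (mul_mem_square x y) hz).1
      rwa [mul_sub, sub_eq_zero] at this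
    rw [e', e, add_mul, add_mul, square_mul_mul hw, square_mul_mul hw', add_zero, add_zero]
    exact mul_mem_range hb hc
  have hlieB (x y : FreeMP k X) : ∃ b ∈ B ⊓ square k X, ∃ w ∈ square k X, ∃ z,
      ∃ w' ∈ square k X, ∃ z', ⁅x, y⁆ = b + ⁅w, z⁆ + ⁅w', z'⁆ := by
    obtain ⟨b, hb, hx⟩ := hdec x
    obtain ⟨c, hc, hy⟩ := hdec y
    refine ⟨⁅b, c⁆, Submodule.mem_inf.mpr ⟨lie_mem_range hb hc, lie_mem_square _ _⟩,
      _, hx, y, _, Submodule.neg_mem _ hy, b, ?_⟩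
    rw [neg_lie, lie_skew, sub_lie, lie_sub]
    abel
  have hsq1 (w : FreeMP k X) (hw : w ∈ square k X) (z : FreeMP k X) :
      ⁅w, z⁆ ∈ B ⊓ square k X ⊔ productSpan k X := by
    induction hw using Submodule.span_induction with
    | mem w hw =>
      obtain ⟨x, y, rfl | rfl⟩ := hw
      · exact Submodule.mem_sup_right (lie_mem_productSpan (mul_mem_productSpan x y) z)
      · obtain ⟨b, hb, w, hw, u, w', hw', u', e⟩ := hlieB x y
        rw [e, add_lie, add_lie]
        exact Submodule.add_mem _ (Submodule.add_mem _ (Submodule.mem_sup_left (hI b hb z).2)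
          (hlie w hw u z)) (hlie w' hw' u' z)
    | zero => rw [zero_lie]; exact Submodule.zero_mem _
    | add a b _ _ ha hb => rw [add_lie]; exact Submodule.add_mem _ ha hb
    | smul t a _ ha => rw [smul_lie]; exact Submodule.smul_mem _ t ha
  have hsq2 : square k X ≤ B ⊓ square k X ⊔ productSpan k X := by
    refine Submodule.span_le.mpr ?_
    rintro _ ⟨x, y, rfl | rfl⟩
    · exact Submodule.mem_sup_right (mul_mem_productSpan x y)
    · obtain ⟨b, hb, w, hw, u, w', hw', u', e⟩ := hlieB x y
      rw [e]
      exact Submodule.add_mem _ (Submodule.add_mem _ (Submodule.mem_sup_left hb)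
        (hsq1 w hw u)) (hsq1 w' hw' u')
  have hsq3 (w : FreeMP k X) (hw : w ∈ square k X) (z : FreeMP k X) : w * z ∈ B := by
    obtain ⟨b, hb, p, hp, rfl⟩ := Submodule.mem_sup.mp (hsq2 hw)
    rw [add_mul]
    refine Submodule.add_mem _ (Submodule.mem_inf.mp (hI b hb z).1).1 ?_
    clear hw
    induction hp using Submodule.span_induction with
    | mem w hw =>
      obtain ⟨x, y, rfl⟩ := hw
      exact hmulmul x y z
    | zero => rw [zero_mul]; exact Submodule.zero_mem _
    | add a b _ _ ha hb => rw [add_mul]; exact Submodule.add_mem _ ha hb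
    | smul t a _ ha => rw [smul_mul']; exact Submodule.smul_mem _ t ha
  have hprod : productSpan k X ≤ B := by
    refine Submodule.span_le.mpr ?_
    rintro _ ⟨x, y, rfl⟩
    obtain ⟨b, hb, w, hw, u, w', hw', u', e⟩ := hmulB x y
    rw [e]
    exact Submodule.add_mem _ (Submodule.add_mem _ hb (hsq3 w hw u)) (hsq3 w' hw' u')
  have hsq : square k X ≤ B := hsq2.trans (sup_le inf_le_left hprod)
  intro f
  obtain ⟨b, hb, hf⟩ := hdec f
  rw [← sub_add_cancel f b]
  exact Submodule.add_mem B (hsq hf) hb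

/-- An endomorphism of a free metabelian Poisson algebra of finite rank is an automorphism if and
only if its Jacobian matrix is invertible. -/
theorem bijective_iff_isUnit_det_jacobian (φ : PoissonHom k (FreeMP k X) (FreeMP k X)) :
    Function.Bijective φ ↔ IsUnit (jacobian φ).det :=
  ⟨fun h => isUnit_det_jacobian_of_surjective φ h.surjective,
    fun h => bijective_of_surjective (surjective_of_isUnit_det_jacobian h)⟩

end Jacobian

end FreeMP

/-! ## Computable functions on lists -/

namespace Computable

variable {α β σ : Type*} [Primcodable α] [Primcodable β] [Primcodable σ]

theorem list_foldl {f : α → List β} {g : α → σ} {h : α → σ × β → σ} (hf : Computable f)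
    (hg : Computable g) (hh : Computable₂ h) :
    Computable fun a => (f a).foldl (fun s b => h a (s, b)) (g a) := by
  have hstep : Computable₂ fun (a : α) (p : ℕ × σ) =>
      Option.casesOn (motive := fun _ => σ) ((f a)[p.1]?) p.2 (fun b => h a (p.2, b)) :=
    option_casesOn (list_getElem?.comp (hf.comp fst) (fst.comp snd)) (snd.comp snd)
      (hh.comp (fst.comp fst) (pair (snd.comp (snd.comp fst)) snd)).to₂
  refine (nat_rec (list_length.comp hf) hg hstep).of_eq fun a => ?_
  -- Invariant of the recursion: after `i` steps the state is the fold over the first `i` entries.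
  suffices H : ∀ i, Nat.rec (motive := fun _ => σ) (g a) (fun y IH =>
      Option.casesOn (motive := fun _ => σ) ((f a)[y]?) IH (fun b => h a (IH, b))) i =
      ((f a).take i).foldl (fun s b => h a (s, b)) (g a) by
    have := H (f a).length
    rwa [List.take_length] at this
  intro i
  induction i with
  | zero => rfl
  | succ i ih =>
    simp only [ih, List.take_add_one]
    cases (f a)[i]? <;> simp

theorem list_foldr {f : α → List β} {g : α → σ} {h : α → β × σ → σ} (hf : Computable f)
    (hg : Computable g) (hh : Computable₂ h) :
    Computable fun a => (f a).foldr (fun b s => h a (b, s)) (g a) :=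
  (list_foldl (h := fun a p => h a (p.2, p.1)) (list_reverse.comp hf) hg
    (hh.comp fst (pair (snd.comp snd) (fst.comp snd))).to₂).of_eq fun a => by
      rw [List.foldl_reverse]

theorem list_map {f : α → List β} {g : α → β → σ} (hf : Computable f) (hg : Computable₂ g) :
    Computable fun a => (f a).map (g a) :=
  (list_foldr (h := fun a p => g a p.1 :: p.2) hf (const [])
    (list_cons.comp (hg.comp fst (fst.comp snd)) (snd.comp snd)).to₂).of_eq fun a => by
      induction f a <;> simp [*]

theorem list_flatMap {f : α → List β} {g : α → β → List σ} (hf : Computable f)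
    (hg : Computable₂ g) : Computable fun a => (f a).flatMap (g a) :=
  (list_foldr (h := fun a p => g a p.1 ++ p.2) hf (const [])
    (list_append.comp (hg.comp fst (fst.comp snd)) (snd.comp snd)).to₂).of_eq fun a => by
      induction f a <;> simp [*]

theorem list_casesOn {f : α → List β} {g : α → σ} {h : α → β × List β → σ} (hf : Computable f)
    (hg : Computable g) (hh : Computable₂ h) :
    Computable fun a => List.casesOn (motive := fun _ => σ) (f a) (g a)
      (fun b l => h a (b, l)) :=
  (option_casesOn (Primrec.list_head?.to_comp.comp hf) hg
    (hh.comp fst (pair snd (Primrec.list_tail.to_comp.comp (hf.comp fst)))).to₂).of_eq fun a => by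
      rcases hl : f a with _ | ⟨b, l⟩ <;> simp [hl]

theorem list_rec {f : α → List β} {g : α → σ} {h : α → β × List β × σ → σ} (hf : Computable f)
    (hg : Computable g) (hh : Computable₂ h) :
    Computable fun a => List.rec (motive := fun _ => σ) (g a) (fun b l s => h a (b, l, s))
      (f a) := by
  -- The fold rebuilds the tail alongside the value, since the step of the recursion also consumes
  -- the tail.
  have H : Computable fun a => (f a).foldr (fun b (s : List β × σ) => (b :: s.1, h a (b, s)))
      ([], g a) :=
    list_foldr (h := fun a (p : β × List β × σ) => (p.1 :: p.2.1, h a p)) hf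
      (pair (const []) hg)
      (pair (list_cons.comp (fst.comp snd) (fst.comp (snd.comp snd))) (hh.comp fst snd)).to₂
  refine (snd.comp H).of_eq fun a => ?_
  suffices H : ∀ l : List β,
      l.foldr (fun b (s : List β × σ) => (b :: s.1, h a (b, s))) ([], g a) =
        (l, List.rec (motive := fun _ => σ) (g a) (fun b l s => h a (b, l, s)) l) by
    rw [H]
  intro l
  induction l with
  | nil => rfl
  | cons b l ih => simp [ih]

theorem list_all {f : α → List β} {g : α → β → Bool} (hf : Computable f) (hg : Computable₂ g) :
    Computable fun a => (f a).all (g a) :=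
  (list_foldr (h := fun a p => g a p.1 && p.2) hf (const true)
    (Primrec.and.to_comp.comp (hg.comp fst (fst.comp snd)) (snd.comp snd)).to₂).of_eq fun a => by
      induction f a <;> simp [*]

theorem decide_eq [DecidableEq β] {f g : α → β} (hf : Computable f) (hg : Computable g) :
    Computable fun a => decide (f a = g a) :=
  (Primrec.eq (α := β)).decide.to_comp.comp hf hg

end Computable

namespace FreeMP

open Computable

variable {k : Type u} [Field k]

/-! ## Jacobian determinants of finite descriptions -/

/-- The nonzero entries of the vector of Fox derivatives of `t · [a, a₂, …, aₘ] · c₁ ⋯ cₛ`, as a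
list of coefficients, indices of letters, and lists of variables. -/
def foxTerms (t : k × ℕ × List ℕ × List ℕ) : List (k × ℕ × List ℕ) :=
  List.casesOn t.2.2.2
    (List.casesOn t.2.2.1 [(t.1, t.2.1, [])]
      (fun b l => [(t.1, t.2.1, b :: l), (-t.1, b, t.2.1 :: l)]))
    (fun _ _ => [])

/-- The product of a sum of multiples of words in the unit vectors with a vector. -/
def mulRow (T : List (k × List ℕ × List ℕ)) (r : List (k × ℕ × List ℕ)) :
    List (k × List ℕ × List ℕ) :=
  T.flatMap fun x => r.map fun y => (x.1 * y.1, x.2.1 ++ [y.2.1], x.2.2 ++ y.2.2)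

/-- The expansion of the exterior product of the rows of the Jacobian matrix: a list of
coefficients, lists of columns and lists of variables. -/
def wedgeTerms (L : List (FormalPoly k)) : List (k × List ℕ × List ℕ) :=
  L.foldl (fun T p => mulRow T (p.flatMap foxTerms)) [(1, [], [])]

/-- The sign of the comparison of two numbers. -/
def pairSign (k : Type u) [Field k] (a b : ℕ) : k := if a < b then 1 else if b < a then -1 else 0

/-- The sign of a list of numbers, zero if there is a repetition. -/
def listSign (k : Type u) [Field k] (l : List ℕ) : k :=
  List.rec 1 (fun a l s => (l.map (pairSign k a)).prod * s) l

/-- The exponents of the variables with numbers below `n` in a list of variables. -/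
def expVec (n : ℕ) (m : List ℕ) : List ℕ :=
  (List.range n).map fun i => (m.filter (· = i)).length

/-- The coefficients and exponents of the terms of the Jacobian determinant. -/
def detTerms (L : List (FormalPoly k)) : List (k × List ℕ) :=
  (wedgeTerms L).map fun t =>
    (if t.2.1.length = L.length ∧ ∀ i ∈ t.2.1 ++ t.2.2, i < L.length then
      t.1 * listSign k t.2.1 else 0, expVec L.length t.2.2)

/-- The coefficient of a monomial in a list of terms. -/
def coeffAt (T : List (k × List ℕ)) (e : List ℕ) : k :=
  (T.map fun t => if t.2 = e then t.1 else 0).sum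

open Classical in
/-- The test whether the Jacobian determinant is a nonzero constant. -/
noncomputable def isUnitTest (L : List (FormalPoly k)) : Bool :=
  !decide (coeffAt (detTerms L) (expVec L.length []) = 0) &&
    (detTerms L).all fun t =>
      decide (t.2 = expVec L.length []) || decide (coeffAt (detTerms L) t.2 = 0)

/-! ### Computability of the Jacobian test. -/

section Computability

variable [Primcodable k] (hk : IsComputableField k)
include hk

theorem computable_foxTerms : Computable (foxTerms (k := k)) := by
  refine list_casesOn (snd.comp (snd.comp snd)) (list_casesOn
    (h := fun (t : k × ℕ × List ℕ × List ℕ) (p : ℕ × List ℕ) =>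
      [(t.1, t.2.1, p.1 :: p.2), (-t.1, p.1, t.2.1 :: p.2)])
    (fst.comp (snd.comp snd)) ?_ ?_) (const []).to₂
  · exact list_cons.comp (pair fst (pair (fst.comp snd) (const []))) (const [])
  · exact list_cons.comp (pair (fst.comp fst) (pair (fst.comp (snd.comp fst))
      (list_cons.comp (fst.comp snd) (snd.comp snd))))
      (list_cons.comp (pair (hk.neg.comp (fst.comp fst)) (pair (fst.comp snd)
        (list_cons.comp (fst.comp (snd.comp fst)) (snd.comp snd)))) (const []))

theorem computable_mulTerm : Computable₂ fun (x : k × List ℕ × List ℕ) (y : k × ℕ × List ℕ) =>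
    ((x.1 * y.1, x.2.1 ++ [y.2.1], x.2.2 ++ y.2.2) : k × List ℕ × List ℕ) :=
  pair (hk.mul.comp (fst.comp fst) (fst.comp snd))
    (pair (list_concat.comp (fst.comp (snd.comp fst)) (fst.comp (snd.comp snd)))
      (list_append.comp (snd.comp (snd.comp fst)) (snd.comp (snd.comp snd))))

theorem computable_mulRow : Computable₂ (mulRow (k := k)) := by
  have h : Computable₂ fun (r : List (k × ℕ × List ℕ)) (x : k × List ℕ × List ℕ) =>
      r.map fun y => ((x.1 * y.1, x.2.1 ++ [y.2.1], x.2.2 ++ y.2.2) : k × List ℕ × List ℕ) :=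
    list_map fst ((computable_mulTerm hk).comp (snd.comp fst) snd).to₂
  exact list_flatMap fst (h.comp (snd.comp fst) snd).to₂

theorem computable_wedgeTerms : Computable (wedgeTerms (k := k)) := by
  have h1 : Computable fun p : FormalPoly k => p.flatMap foxTerms :=
    list_flatMap Computable.id ((computable_foxTerms hk).comp snd).to₂
  have h2 : Computable₂ fun (_ : List (FormalPoly k))
      (p : List (k × List ℕ × List ℕ) × FormalPoly k) => mulRow p.1 (p.2.flatMap foxTerms) :=
    (computable_mulRow hk).comp (fst.comp snd) (h1.comp (snd.comp snd))
  exact list_foldl Computable.id (const _) h2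

omit hk in
theorem computable_pairSign : Computable₂ (pairSign k) :=
  (Primrec.ite (Primrec.nat_lt.comp Primrec.fst Primrec.snd) (Primrec.const 1)
    (Primrec.ite (Primrec.nat_lt.comp Primrec.snd Primrec.fst) (Primrec.const (-1))
      (Primrec.const 0))).to_comp

theorem computable_listProd : Computable (List.prod : List k → k) :=
  (list_foldr (h := fun _ p => p.1 * p.2) Computable.id (const 1)
    (hk.mul.comp (fst.comp snd) (snd.comp snd)).to₂).of_eq fun _ => rfl

theorem computable_listSum : Computable (List.sum : List k → k) :=
  (list_foldr (h := fun _ p => p.1 + p.2) Computable.id (const 0)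
    (hk.add.comp (fst.comp snd) (snd.comp snd)).to₂).of_eq fun _ => rfl

theorem computable_listSign : Computable (listSign k) := by
  have h1 : Computable₂ fun (a : ℕ) (l : List ℕ) => l.map (pairSign k a) :=
    list_map snd (computable_pairSign.comp (fst.comp fst) snd).to₂
  have h2 : Computable₂ fun (_ : List ℕ) (p : ℕ × List ℕ × k) =>
      (p.2.1.map (pairSign k p.1)).prod * p.2.2 :=
    hk.mul.comp ((computable_listProd hk).comp
      (h1.comp (fst.comp snd) (fst.comp (snd.comp snd)))) (snd.comp (snd.comp snd))
  exact list_rec Computable.id (const 1) h2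

omit hk in
theorem computable_expVec : Computable₂ expVec := by
  have h : Primrec₂ fun (m : List ℕ) (i : ℕ) => m.filter (· = i) :=
    PrimrecRel.listFilter (R := fun a b => a = b) Primrec.eq
  refine list_map (Primrec.list_range.to_comp.comp fst) ?_
  exact (list_length.comp (h.to_comp.comp (snd.comp fst) snd)).to₂

theorem computable_detTerms : Computable (detTerms (k := k)) := by
  have h1 : Computable fun p : List (FormalPoly k) × k × List ℕ × List ℕ =>
      (decide (p.2.2.1.length = p.1.length) &&
        (p.2.2.1 ++ p.2.2.2).all fun i => decide (i < p.1.length)) :=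
    Primrec.and.to_comp.comp
      (decide_eq (list_length.comp (fst.comp (snd.comp snd))) (list_length.comp fst))
      (list_all (list_append.comp (fst.comp (snd.comp snd)) (snd.comp (snd.comp snd)))
        (Primrec.nat_lt.decide.to_comp.comp snd (list_length.comp (fst.comp fst))).to₂)
  have h2 : Computable fun p : List (FormalPoly k) × k × List ℕ × List ℕ =>
      p.2.1 * listSign k p.2.2.1 :=
    hk.mul.comp (fst.comp snd) ((computable_listSign hk).comp (fst.comp (snd.comp snd)))
  have h3 : Computable fun p : List (FormalPoly k) × k × List ℕ × List ℕ =>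
      if p.2.2.1.length = p.1.length ∧ ∀ i ∈ p.2.2.1 ++ p.2.2.2, i < p.1.length then
        p.2.1 * listSign k p.2.2.1 else 0 :=
    (cond h1 h2 (const 0)).of_eq fun p => by
      rw [Bool.cond_eq_ite]
      simp only [Bool.and_eq_true, decide_eq_true_eq, List.all_eq_true]
  have h4 : Computable fun p : List (FormalPoly k) × k × List ℕ × List ℕ =>
      expVec p.1.length p.2.2.2 :=
    computable_expVec.comp (list_length.comp fst) (snd.comp (snd.comp snd))
  exact list_map (computable_wedgeTerms hk) (pair h3 h4).to₂

theorem computable_coeffAt : Computable₂ (coeffAt (k := k)) := by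
  refine (computable_listSum hk).comp (list_map fst ?_)
  refine (cond (decide_eq (snd.comp snd) (snd.comp fst)) (fst.comp snd) (const 0)).of_eq
    fun p => ?_
  rw [Bool.cond_eq_ite]
  simp only [decide_eq_true_eq]

/-- The classical `decide` in the test does no harm: `Computable` concerns the function only, and
`decide_eq` accepts any instance of decidable equality. -/
theorem computable_isUnitTest : Computable (isUnitTest (k := k)) := by
  classical
  have hz : Computable fun L : List (FormalPoly k) => expVec L.length [] :=
    computable_expVec.comp list_length (const [])
  refine (Primrec.and.to_comp.comp (Primrec.not.to_comp.comp (decide_eq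
    ((computable_coeffAt hk).comp (computable_detTerms hk) hz) (const 0)))
    (list_all (computable_detTerms hk) (Primrec.or.to_comp.comp
      (decide_eq (snd.comp snd) (hz.comp fst)) (decide_eq
        ((computable_coeffAt hk).comp ((computable_detTerms hk).comp fst) (snd.comp snd))
        (const 0))).to₂)).of_eq fun L => ?_
  simp only [isUnitTest]

end Computability


/-! ## Correctness of the expansion of the Jacobian determinant -/

/-- The variable with number `i`, zero if there is none. -/
noncomputable def natVar (k : Type u) [Field k] (n i : ℕ) : MvPolynomial (Fin n) k :=
  linForm (letterNat k n i)

/-- The unit vector with number `i`, zero if there is none. -/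
noncomputable def natUnit (k : Type u) [Field k] (n i : ℕ) : Fin n → MvPolynomial (Fin n) k :=
  fox (letterNat k n i)

theorem natVar_of_lt {n i : ℕ} (h : i < n) : natVar k n i = MvPolynomial.X ⟨i, h⟩ := by
  rw [natVar, letterNat, dif_pos h, linForm_letter]

theorem natUnit_of_lt {n i : ℕ} (h : i < n) : natUnit k n i = Pi.single ⟨i, h⟩ 1 := by
  rw [natUnit, letterNat, dif_pos h, fox_letter]

theorem natUnit_of_le {n i : ℕ} (h : n ≤ i) : natUnit k n i = 0 := by
  rw [natUnit, letterNat, dif_neg h.not_gt, map_zero]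

theorem fox_foldl_lie {n : ℕ} (l : List ℕ) {W : FreeMP k (Fin n)} (hW : W ∈ square k (Fin n)) :
    fox (l.foldl (fun W i => ⁅W, letterNat k n i⁆) W) = (l.map (natVar k n)).prod • fox W := by
  induction l generalizing W with
  | nil => simp
  | cons i l ih =>
    rw [List.foldl_cons, ih (lie_mem_square _ _), fox_lie, linForm_eq_zero hW, zero_smul, sub_zero,
      List.map_cons, List.prod_cons, mul_comm, mul_smul, natVar]

/-- The vector described by a term. -/
noncomputable def vecVal (n : ℕ) (y : k × ℕ × List ℕ) : Fin n → MvPolynomial (Fin n) k :=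
  (MvPolynomial.C y.1 * (y.2.2.map (natVar k n)).prod) • natUnit k n y.2.1

/-- A bracket [a, b] has Fox vector X_b e_a − X_a e_b, each further bracket multiplies it by a
variable, and any product has Fox vector zero. -/
theorem fox_smul_evalMonomial (n : ℕ) (t : k × ℕ × List ℕ × List ℕ) :
    fox (t.1 • evalMonomial k n t.2.1 t.2.2.1 t.2.2.2) =
      ((foxTerms t).map (vecVal n)).sum := by
  obtain ⟨t, a, l, c⟩ := t
  rw [map_smul, ← algebraMap_smul (MvPolynomial (Fin n) k) t, MvPolynomial.algebraMap_eq]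
  rcases c with _ | ⟨i, c⟩
  · rcases l with _ | ⟨b, l⟩
    · simp [foxTerms, evalMonomial, vecVal, natUnit]
    · have h : evalMonomial k n a (b :: l) [] = l.foldl (fun W i => ⁅W, letterNat k n i⁆)
          ⁅letterNat k n a, letterNat k n b⁆ := rfl
      simp only [h, fox_foldl_lie l (lie_mem_square _ _), fox_lie, foxTerms, List.map_cons,
        List.map_nil, List.sum_cons, List.sum_nil, vecVal, List.prod_cons, map_neg]
      change _ • _ • (natVar k n b • natUnit k n a - natVar k n a • natUnit k n b) = _
      module
  · have h : fox (evalMonomial k n a l (i :: c)) = 0 := by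
      rcases (i :: c).eq_nil_or_concat' with h | ⟨c', j, h⟩
      · simp at h
      · rw [h]
        simp [evalMonomial, fox_mul]
    simp [h, foxTerms]

theorem fox_evalPoly (n : ℕ) (p : FormalPoly k) :
    fox (evalPoly n p) = ((p.flatMap foxTerms).map (vecVal n)).sum := by
  induction p with
  | nil => simp [evalPoly]
  | cons t p ih =>
    rw [List.flatMap_cons, List.map_append, List.sum_append, ← ih, ← fox_smul_evalMonomial,
      ← map_add]
    rfl

/-- The element of the exterior algebra described by a term. -/
noncomputable def extVal (n : ℕ) (x : k × List ℕ × List ℕ) :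
    ExteriorAlgebra (MvPolynomial (Fin n) k) (Fin n → MvPolynomial (Fin n) k) :=
  (MvPolynomial.C x.1 * (x.2.2.map (natVar k n)).prod) •
    (x.2.1.map fun i => ExteriorAlgebra.ι _ (natUnit k n i)).prod

theorem extVal_mul (n : ℕ) (x : k × List ℕ × List ℕ) (y : k × ℕ × List ℕ) :
    extVal n (x.1 * y.1, x.2.1 ++ [y.2.1], x.2.2 ++ y.2.2) =
      extVal n x * ExteriorAlgebra.ι _ (vecVal n y) := by
  simp only [extVal, vecVal, List.map_append, List.prod_append, List.map_cons, List.map_nil,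
    List.prod_singleton, map_mul, map_smul, smul_mul_smul_comm]
  congr 1
  ring

theorem sum_extVal_mulRow (n : ℕ) (T : List (k × List ℕ × List ℕ)) (r : List (k × ℕ × List ℕ)) :
    ((mulRow T r).map (extVal n)).sum =
      (T.map (extVal n)).sum * ExteriorAlgebra.ι _ (r.map (vecVal n)).sum := by
  induction T with
  | nil => simp [mulRow]
  | cons x T ih =>
    rw [mulRow, List.flatMap_cons, List.map_append, List.sum_append, ← mulRow, ih, List.map_cons,
      List.sum_cons, add_mul]
    congr 1
    clear ih
    induction r with
    | nil => simp
    | cons y r ih' =>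
      simp only [List.map_cons, List.sum_cons, map_add, mul_add, extVal_mul]
      rw [← ih']

theorem sum_extVal_wedgeTerms (n : ℕ) (L : List (FormalPoly k)) :
    ((wedgeTerms L).map (extVal n)).sum =
      (L.map fun p => ExteriorAlgebra.ι _ (fox (evalPoly n p))).prod := by
  have h (T : List (k × List ℕ × List ℕ)) :
      ((L.foldl (fun T p => mulRow T (p.flatMap foxTerms)) T).map (extVal n)).sum =
        (T.map (extVal n)).sum *
          (L.map fun p => ExteriorAlgebra.ι _ (fox (evalPoly n p))).prod := by
    induction L generalizing T with
    | nil => simp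
    | cons p L ih =>
      rw [List.foldl_cons, ih, sum_extVal_mulRow, ← fox_evalPoly, List.map_cons, List.prod_cons,
        mul_assoc]
  rw [wedgeTerms, h]
  simp [extVal]

theorem prod_map_ι {R M α : Type*} [CommRing R] [AddCommGroup M] [Module R M] (l : List α)
    (f : α → M) : (l.map fun a => ExteriorAlgebra.ι R (f a)).prod =
      ExteriorAlgebra.ιMulti R l.length fun i => f (l.get i) := by
  rw [ExteriorAlgebra.ιMulti_apply]
  congr 1
  refine List.ext_get (by simp) fun i h1 h2 => ?_
  simp

/-- The determinant as a linear form on the exterior algebra. -/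
noncomputable def detForm (R : Type*) [CommRing R] (n : ℕ) :
    ExteriorAlgebra R (Fin n → R) →ₗ[R] R :=
  ExteriorAlgebra.liftAlternating (Pi.single n Matrix.detRowAlternating)

theorem detForm_prod_of_length {R : Type*} [CommRing R] {α : Type*} (l : List α)
    (f : α → Fin l.length → R) :
    detForm R l.length (l.map fun a => ExteriorAlgebra.ι R (f a)).prod =
      (Matrix.of fun i => f (l.get i)).det := by
  rw [prod_map_ι, detForm, ExteriorAlgebra.liftAlternating_apply_ιMulti, Pi.single_eq_same]
  rfl

theorem detForm_prod_of_length_ne {R : Type*} [CommRing R] {α : Type*} (l : List α) {n : ℕ}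
    (hn : l.length ≠ n) (f : α → Fin n → R) :
    detForm R n (l.map fun a => ExteriorAlgebra.ι R (f a)).prod = 0 := by
  rw [prod_map_ι, detForm, ExteriorAlgebra.liftAlternating_apply_ιMulti, Pi.single_eq_of_ne hn]
  rfl

theorem listSign_ofFn {n : ℕ} (f : Fin n → ℕ) :
    listSign k (List.ofFn f) = ∏ i, ∏ j ∈ Finset.Ioi i, pairSign k (f i) (f j) := by
  induction n with
  | zero => simp [listSign]
  | succ n ih =>
    rw [List.ofFn_succ, Fin.prod_univ_succ, Fin.prod_Ioi_zero]
    simp only [Fin.prod_Ioi_succ]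
    rw [← ih fun i => f i.succ]
    simp only [listSign, List.map_ofFn, List.prod_ofFn, Function.comp_apply]

/-- The sign of a permutation is the product over pairs i < j of the comparison signs of the values.
-/
theorem listSign_perm {n : ℕ} (σ : Equiv.Perm (Fin n)) :
    listSign k (List.ofFn fun i => (σ i : ℕ)) = ((σ.sign : ℤ) : k) := by
  rw [listSign_ofFn, σ.sign_eq_prod_prod_Ioi]
  push_cast
  refine Finset.prod_congr rfl fun i _ => Finset.prod_congr rfl fun j hj => ?_
  have hne : σ i ≠ σ j := fun h => (Finset.mem_Ioi.mp hj).ne (σ.injective h)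
  rcases lt_or_gt_of_ne hne with h | h
  · have h' : (σ i : ℕ) < σ j := h
    simp [pairSign, h, h']
  · have h' : (σ j : ℕ) < σ i := h
    simp [pairSign, h.not_gt, h', h'.not_gt]

/-- The rows are unit vectors or zero. A number out of range gives a zero row, a repetition gives
two equal rows, and otherwise the matrix is a permutation matrix. -/
theorem detForm_natUnit (n : ℕ) (l : List ℕ) :
    detForm _ n (l.map fun i => ExteriorAlgebra.ι _ (natUnit k n i)).prod =
      if l.length = n ∧ ∀ i ∈ l, i < n then MvPolynomial.C (listSign k l) else 0 := by
  by_cases hn : l.length = n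
  swap
  · rw [detForm_prod_of_length_ne l hn, if_neg fun h => hn h.1]
  subst hn
  rw [detForm_prod_of_length]
  by_cases hl : ∀ i ∈ l, i < l.length
  swap
  · rw [if_neg fun h => hl h.2]
    push Not at hl
    obtain ⟨a, ha, hla⟩ := hl
    obtain ⟨i, rfl⟩ := List.get_of_mem ha
    refine Matrix.det_eq_zero_of_row_eq_zero i fun j => ?_
    rw [Matrix.of_apply, natUnit_of_le hla, Pi.zero_apply]
  rw [if_pos ⟨rfl, hl⟩]
  let g : Fin l.length → Fin l.length := fun i => ⟨l.get i, hl _ (l.get_mem i)⟩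
  have hg (i) : natUnit k l.length (l.get i) = Pi.single (g i) 1 := natUnit_of_lt _
  have hlg : l = List.ofFn fun i => (g i : ℕ) := (List.ofFn_get l).symm
  simp only [hg]
  by_cases hinj : Function.Injective g
  · let σ : Equiv.Perm (Fin l.length) := Equiv.ofBijective g hinj.bijective_of_finite
    have h := Matrix.det_permute σ (1 : Matrix (Fin l.length) (Fin l.length)
      (MvPolynomial (Fin l.length) k))
    rw [Matrix.det_one, mul_one] at h
    have hs : listSign k l = ((σ.sign : ℤ) : k) := by
      rw [← listSign_perm]
      exact congrArg (listSign k) hlg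
    rw [hs, map_intCast, ← h]
    congr 1
    ext1 i j
    rw [Matrix.of_apply, Matrix.submatrix_apply, Matrix.one_apply, Pi.single_apply]
    simp only [id, eq_comm]
    rfl
  · have hne : ∃ i j, g i = g j ∧ i < j := by
      simp only [Function.Injective] at hinj
      push Not at hinj
      obtain ⟨i, j, h, hij⟩ := hinj
      rcases lt_or_gt_of_ne hij with h' | h'
      · exact ⟨i, j, h, h'⟩
      · exact ⟨j, i, h.symm, h'⟩
    obtain ⟨i, j, h, hij⟩ := hne
    have hs : listSign k l = 0 := by
      have e := congrArg (listSign k) hlg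
      rw [listSign_ofFn] at e
      rw [e]
      refine Finset.prod_eq_zero (Finset.mem_univ i)
        (Finset.prod_eq_zero (Finset.mem_Ioi.mpr hij) ?_)
      simp [h, pairSign]
    rw [hs, map_zero]
    refine Matrix.det_zero_of_row_eq hij.ne ?_
    change (Pi.single (g i) 1 : Fin l.length → MvPolynomial (Fin l.length) k) = Pi.single (g j) 1
    rw [h]

/-- The exponents of a list of variables. -/
noncomputable def expFun (n : ℕ) (m : List ℕ) : Fin n →₀ ℕ :=
  Finsupp.equivFunOnFinite.symm fun i => (m.filter (· = (i : ℕ))).length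

/-- Lets the test compare lists of exponents in place of exponents of polynomials. -/
theorem expVec_inj {n : ℕ} {m m' : List ℕ} :
    expVec n m = expVec n m' ↔ expFun n m = expFun n m' := by
  rw [expVec, expVec, List.map_inj_left, expFun, expFun, EmbeddingLike.apply_eq_iff_eq,
    funext_iff]
  simp only [List.mem_range]
  exact ⟨fun h i => h i i.2, fun h i hi => h ⟨i, hi⟩⟩

theorem prod_natVar {n : ℕ} {m : List ℕ} (hm : ∀ i ∈ m, i < n) :
    (m.map (natVar k n)).prod = MvPolynomial.monomial (expFun n m) 1 := by
  induction m with
  | nil =>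
    have : expFun n [] = 0 := by ext; simp [expFun]
    rw [this]; rfl
  | cons i m ih =>
    have hi : i < n := hm i (by simp)
    have e : expFun n (i :: m) = Finsupp.single ⟨i, hi⟩ 1 + expFun n m := by
      ext j
      by_cases h : i = j
      · subst h
        simp [expFun, add_comm]
      · have h' : (⟨i, hi⟩ : Fin n) ≠ j := fun hh => h (congrArg Fin.val hh)
        simp [expFun, h, h']
    rw [List.map_cons, List.prod_cons, ih fun j hj => hm j (by simp [hj]), natVar_of_lt hi, e,
      MvPolynomial.X, MvPolynomial.monomial_mul, one_mul]

/-- `expFun` ignores variables out of range, although their value is zero; hence the condition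
covers the list of variables as well as the columns. -/
theorem detForm_extVal (n : ℕ) (t : k × List ℕ × List ℕ) :
    detForm _ n (extVal n t) = MvPolynomial.monomial (expFun n t.2.2)
      (if t.2.1.length = n ∧ ∀ i ∈ t.2.1 ++ t.2.2, i < n then t.1 * listSign k t.2.1 else 0) := by
  rw [extVal, map_smul, detForm_natUnit]
  by_cases h1 : t.2.1.length = n ∧ ∀ i ∈ t.2.1, i < n
  · rw [if_pos h1]
    by_cases h2 : ∀ i ∈ t.2.2, i < n
    · rw [if_pos ⟨h1.1, fun i hi => (List.mem_append.mp hi).elim (h1.2 i) (h2 i)⟩,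
        prod_natVar h2, smul_eq_mul, MvPolynomial.C_mul_monomial, mul_comm,
        MvPolynomial.C_mul_monomial, mul_one, mul_comm]
    · rw [if_neg fun h => h2 fun i hi => h.2 i (List.mem_append_right _ hi), map_zero]
      push Not at h2
      obtain ⟨i, hi, hn⟩ := h2
      rw [List.prod_eq_zero (List.mem_map.mpr ⟨i, hi, ?_⟩), mul_zero, zero_smul]
      rw [natVar, letterNat, dif_neg hn.not_gt, map_zero]
  · rw [if_neg h1, smul_zero, if_neg fun h => h1 ⟨h.1, fun i hi =>
      h.2 i (List.mem_append_left _ hi)⟩, map_zero]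

/-- The exterior product of the rows is computed by `wedgeTerms`, and `detForm` sends it to the
determinant. -/
theorem det_jacobian_endOfList (L : List (FormalPoly k)) :
    (jacobian (endOfList L)).det =
      ((wedgeTerms L).map fun t => detForm _ L.length (extVal L.length t)).sum := by
  rw [← Function.comp_def, ← List.map_map, ← map_list_sum, sum_extVal_wedgeTerms,
    detForm_prod_of_length]
  rfl

theorem coeff_det_jacobian_endOfList (L : List (FormalPoly k)) (m : List ℕ) :
    MvPolynomial.coeff (expFun L.length m) (jacobian (endOfList L)).det =
      coeffAt (detTerms L) (expVec L.length m) := by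
  rw [det_jacobian_endOfList, coeffAt, detTerms, List.map_map, ← MvPolynomial.lcoeff_apply,
    map_list_sum, List.map_map]
  congr 2
  funext t
  simp only [Function.comp_apply, detForm_extVal, MvPolynomial.lcoeff_apply,
    MvPolynomial.coeff_monomial, expVec_inj]

/-- A polynomial over a field is a unit exactly if it is a nonzero constant. Coefficients may cancel
between terms, so they are summed for each exponent before testing. -/
theorem isUnit_det_jacobian_endOfList_iff (L : List (FormalPoly k)) :
    IsUnit (jacobian (endOfList L)).det ↔ isUnitTest L = true := by
  have h0 : expFun L.length [] = 0 := by ext; simp [expFun]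
  rw [MvPolynomial.isUnit_iff, isUnit_iff_ne_zero, ← h0, coeff_det_jacobian_endOfList]
  simp only [isUnitTest, Bool.and_eq_true, Bool.not_eq_true', decide_eq_false_iff_not,
    List.all_eq_true, Bool.or_eq_true, decide_eq_true_eq, isNilpotent_iff_eq_zero]
  refine and_congr Iff.rfl ⟨fun h t ht => ?_, fun h e he => ?_⟩
  · obtain ⟨s, -, rfl⟩ := List.mem_map.mp ht
    rw [or_iff_not_imp_left, expVec_inj, ← coeff_det_jacobian_endOfList]
    exact h _
  · by_contra hne
    -- An exponent that occurs in no term has coefficient zero, so checking the listed exponents is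
    -- enough.
    have hs : ∃ t ∈ wedgeTerms L, expFun L.length t.2.2 = e := by
      by_contra! hs
      refine hne ?_
      rw [det_jacobian_endOfList, ← MvPolynomial.lcoeff_apply, map_list_sum, List.map_map]
      refine List.sum_eq_zero fun c hc => ?_
      obtain ⟨t, ht, rfl⟩ := List.mem_map.mp hc
      simp [detForm_extVal, MvPolynomial.coeff_monomial, hs t ht]
    obtain ⟨t, ht, rfl⟩ := hs
    rw [coeff_det_jacobian_endOfList] at hne
    rcases h _ (List.mem_map.mpr ⟨t, ht, rfl⟩) with h | h
    · exact he (expVec_inj.mp h)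
    · exact hne h

theorem bijective_endOfList_iff (L : List (FormalPoly k)) :
    Function.Bijective (endOfList L) ↔ isUnitTest L = true :=
  (bijective_iff_isUnit_det_jacobian _).trans (isUnit_det_jacobian_endOfList_iff L)

theorem computablePred_bijective_endOfList [Primcodable k] (hk : IsComputableField k) :
    ComputablePred fun L : List (FormalPoly k) => Function.Bijective (endOfList L) :=
  ComputablePred.computable_iff.mpr
    ⟨isUnitTest, computable_isUnitTest hk, funext fun L => propext (bijective_endOfList_iff L)⟩

end FreeMP

theorem theorem3p22 {k : Type u} [Field k] :
    (∀ (X : Type v) [Finite X] (φ : PoissonHom k (FreeMP k X) (FreeMP k X)),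
      Function.Bijective φ ↔
        Function.Bijective (FreeMP.inducedLinear φ) ∧
        ∀ m : X, (FreeMP.nonlinearPart (φ (FreeMP.letter k m)) : FreeMP k X) ∈
          poissonIdeal k
            {s : FreeMP k X | ∃ i j : X,
              s = ⁅φ (FreeMP.letter k i), φ (FreeMP.letter k j)⁆ ∨
              s = φ (FreeMP.letter k i) * φ (FreeMP.letter k j)}) ∧
    (∀ [Primcodable k], IsComputableField k →
      ComputablePred (fun L : List (FreeMP.FormalPoly k) =>
        Function.Bijective (FreeMP.endOfList L))) := by
  exact ⟨fun _ _ φ => FreeMP.bijective_iff_nonlinearPart_mem φ,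
    fun hk => FreeMP.computablePred_bijective_endOfList hk⟩
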